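/- Let $p$ be a prime number and let $\mathcal G=(G,\theta)$ be a torsion-free cyclotomic pro-$p$ pair, that is, $G$ is a pro-$p$ group (not necessarily finitely generated) and $\theta\colon G\to\mathbb Z_p^\times$ is a continuous homomorphism whose image is torsion-free. For $n\ge 1$ let $\mathbb Z_p(1)/p^n$ denote $\mathbb Z_p/p^n\mathbb Z_p$ with the $G$-action $g\cdot z=\theta(g)z$. The pair $\mathcal G$ is called Kummerian if for every $n\ge1$ the map of continuous cohomology groups $$H^1(G,\mathbb Z_p(1)/p^n)\longrightarrow H^1(G,\mathbb Z_p(1)/p)$$ induced by the projection $\mathbb Z_p(1)/p^n\to\mathbb Z_p(1)/p$ is surjective. Let $K(\mathcal G)$ be the closed subgroup of $G$ topologically generated by the elements $h^{-\theta(g)}\,g\,h\,g^{-1}$ with $g\in G$ and $h\in\operatorname{Ker}(\theta)$; it is normal in $G$ and contained in $\operatorname{Ker}(\theta)$. For a cyclotomic pro-$p$ pair $\mathcal H=(H,\vartheta)$ let $Z(\mathcal H)$ be the closed subgroup of $H$ topologically generated by the elements $h\in\operatorname{Ker}(\vartheta)$ such that $ghg^{-1}=h^{\vartheta(g)}$ for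 all $g\in H$; the pair $\mathcal H$ is called $\vartheta$-abelian if $Z(\mathcal H)=\operatorname{Ker}(\vartheta)$ and $Z(\mathcal H)$ is torsion-free. Then the following conditions are equivalent: (i) $\mathcal G$ is Kummerian; (ii) the group $\operatorname{Ker}(\theta)/K(\mathcal G)$ is torsion-free; (iii) the pair $(G/K(\mathcal G),\bar\theta)$, where $\bar\theta\colon G/K(\mathcal G)\to\mathbb Z_p^\times$ is the homomorphism induced by $\theta$, is $\bar\theta$-abelian. -/

import Mathlib

/-! ### Pro-`p` groups and `p`-adic powers -/

/-- A group is torsion-free if the identity is its only element of finite order. -/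
def GroupIsTorsionFree (G : Type*) [Group G] : Prop :=
  ∀ g : G, IsOfFinOrder g → g = 1

/-- A profinite group (compact, Hausdorff, totally disconnected: these are ordinary type class
arguments wherever this is used) is a pro-`p` group if all its quotients by open normal subgroups
are `p`-groups. -/
class IsProP (p : ℕ) (G : Type*) [Group G] [TopologicalSpace G] : Prop where
  isPGroup_quotient : ∀ U : Subgroup G, ∀ [U.Normal], IsOpen (U : Set G) → IsPGroup p (G ⧸ U)

section PadicPow

variable {p : ℕ} [Fact p.Prime] {G : Type*} [Group G] [TopologicalSpace G]

/-- The power `h ^ z` of an element `h` of a pro-`p` group with a `p`-adic integer exponent `z`: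
the limit of the powers `h ^ z_k`, where `z_k` is a natural number congruent to `z` mod `p ^ k`.
The limit exists by `tendsto_padicPow`. -/
noncomputable def padicPow (h : G) (z : ℤ_[p]) : G :=
  Filter.limUnder Filter.atTop (fun k : ℕ => h ^ z.appr k)

theorem tendsto_padicPow [IsTopologicalGroup G] [CompactSpace G] [TotallyDisconnectedSpace G]
    [IsProP p G] (h : G) (z : ℤ_[p]) :
    Filter.Tendsto (fun k : ℕ => h ^ z.appr k) Filter.atTop (nhds (padicPow h z)) := by
  apply tendsto_nhds_limUnder
  obtain ⟨x, hx⟩ := exists_clusterPt_of_compactSpace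
    (Filter.map (fun k : ℕ => h ^ z.appr k) Filter.atTop)
  refine ⟨x, ?_⟩
  rw [Filter.tendsto_def]
  intro s hs
  obtain ⟨W, hWs, hW, hxW⟩ := mem_nhds_iff.1 hs
  have hW1 : IsOpen ((fun y => x * y) ⁻¹' W) := hW.preimage (continuous_const_mul x)
  obtain ⟨U, hU⟩ := ProfiniteGrp.exist_openNormalSubgroup_sub_open_nhds_of_one hW1
    (by simpa using hxW)
  have hUo : IsOpen ((U.toSubgroup : Subgroup G) : Set G) := U.isOpen'
  obtain ⟨m, hm⟩ := IsProP.isPGroup_quotient (p := p) U.toSubgroup hUo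
    (QuotientGroup.mk (s := U.toSubgroup) h)
  rw [← QuotientGroup.mk_pow, QuotientGroup.eq_one_iff] at hm
  have hV : IsOpen ((fun y => x⁻¹ * y) ⁻¹' (U.toSubgroup : Set G)) :=
    hUo.preimage (continuous_const_mul x⁻¹)
  have hfreq := (mapClusterPt_iff_frequently.1 hx) _ (hV.mem_nhds (by simp))
  obtain ⟨k, hkU, hk⟩ := (hfreq.and_eventually (Filter.eventually_ge_atTop m)).exists
  have key : ∀ n, m ≤ n →
      (x⁻¹ * h ^ z.appr m ∈ U.toSubgroup ↔ x⁻¹ * h ^ z.appr n ∈ U.toSubgroup) := by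
    intro n hn
    obtain ⟨c, hc⟩ := z.dvd_appr_sub_appr m n hn
    have he : z.appr n = z.appr m + p ^ m * c := by
      have := z.appr_mono hn
      omega
    rw [he, pow_add, pow_mul, ← mul_assoc]
    exact (Subgroup.mul_mem_cancel_right _ (U.toSubgroup.pow_mem hm c)).symm
  filter_upwards [Filter.eventually_ge_atTop m] with n hn
  have hmem : x⁻¹ * h ^ z.appr n ∈ (U : Set G) := (key n hn).1 ((key k hk).2 hkU)
  have := hU hmem
  exact hWs (by simpa using this)

theorem padicPow_conj [IsTopologicalGroup G] [CompactSpace G] [T2Space G]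
    [TotallyDisconnectedSpace G] [IsProP p G] (g h : G) (z : ℤ_[p]) :
    padicPow (g * h * g⁻¹) z = g * padicPow h z * g⁻¹ := by
  refine tendsto_nhds_unique (tendsto_padicPow (g * h * g⁻¹) z) ?_
  simpa only [conj_pow] using ((tendsto_padicPow h z).const_mul g).mul_const g⁻¹

theorem padicPow_mem [IsTopologicalGroup G] [CompactSpace G] [TotallyDisconnectedSpace G]
    [IsProP p G] {H : Subgroup G} (hH : IsClosed (H : Set G)) {h : G} (hh : h ∈ H) (z : ℤ_[p]) :
    padicPow h z ∈ H :=
  hH.mem_of_tendsto (tendsto_padicPow h z) (Filter.Eventually.of_forall fun _ => H.pow_mem hh _)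

end PadicPow

/-! ### Continuous cohomology in degree one -/

section Cohomology

variable {R : Type*} [CommRing R] {G : Type*} [Group G] [TopologicalSpace G]
  {M : Type*} [AddCommGroup M] [Module R M] [TopologicalSpace M] [IsTopologicalAddGroup M]
  {M' : Type*} [AddCommGroup M'] [Module R M'] [TopologicalSpace M'] [IsTopologicalAddGroup M']

/-- Continuous `1`-cocycles `c : G → M`, where `G` acts on `M` through `ρ`. -/
def contCocycles₁ (ρ : Representation R G M) : AddSubgroup (G → M) where
  carrier := {c | Continuous c ∧ ∀ g₁ g₂, c (g₁ * g₂) = c g₁ + ρ g₁ (c g₂)}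
  zero_mem' := ⟨continuous_const, by simp⟩
  add_mem' := fun {a b} ha hb => ⟨ha.1.add hb.1, fun g₁ g₂ => by
    simp only [Pi.add_apply, ha.2 g₁ g₂, hb.2 g₁ g₂, map_add]; abel⟩
  neg_mem' := fun {a} ha => ⟨ha.1.neg, fun g₁ g₂ => by
    simp only [Pi.neg_apply, ha.2 g₁ g₂, map_neg]; abel⟩

/-- The `1`-coboundaries `g ↦ g • m - m` with `m ∈ M`. -/
def coboundaries₁ (ρ : Representation R G M) : AddSubgroup (G → M) where
  carrier := {c | ∃ m : M, ∀ g, c g = ρ g m - m}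
  zero_mem' := ⟨0, by simp⟩
  add_mem' := by
    rintro a b ⟨m, hm⟩ ⟨m', hm'⟩
    exact ⟨m + m', fun g => by simp only [Pi.add_apply, hm, hm', map_add]; abel⟩
  neg_mem' := by
    rintro a ⟨m, hm⟩
    exact ⟨-m, fun g => by simp only [Pi.neg_apply, hm, map_neg]; abel⟩

/-- The first continuous cohomology group `H¹(G, M)`: continuous `1`-cocycles modulo
`1`-coboundaries (these are cocycles, and continuous if `G` acts continuously on `M`). -/
abbrev ContH1 (ρ : Representation R G M) : Type _ :=
  contCocycles₁ ρ ⧸ (coboundaries₁ ρ).addSubgroupOf (contCocycles₁ ρ)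

/-- Composition of continuous `1`-cocycles with a continuous `G`-equivariant map. -/
def contCocycles₁Map {ρ : Representation R G M} {ρ' : Representation R G M'} (f : M →ₗ[R] M')
    (hf : Continuous f) (hρ : ∀ g m, f (ρ g m) = ρ' g (f m)) :
    contCocycles₁ ρ →+ contCocycles₁ ρ' where
  toFun c := ⟨fun g => f (c.1 g), hf.comp c.2.1, fun g₁ g₂ => by
    change f (c.1 (g₁ * g₂)) = f (c.1 g₁) + ρ' g₁ (f (c.1 g₂))
    rw [c.2.2 g₁ g₂, map_add, hρ]⟩
  map_zero' := by ext g; simp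
  map_add' a b := by ext g; simp

/-- The map `H¹(G, M) → H¹(G, M')` induced by a continuous `G`-equivariant map `M → M'`. -/
def contH1Map {ρ : Representation R G M} {ρ' : Representation R G M'} (f : M →ₗ[R] M')
    (hf : Continuous f) (hρ : ∀ g m, f (ρ g m) = ρ' g (f m)) : ContH1 ρ →+ ContH1 ρ' :=
  QuotientAddGroup.map _ _ (contCocycles₁Map f hf hρ) (by
    rintro c ⟨m, hm⟩
    refine ⟨f m, fun g => ?_⟩
    have h := hm g
    change f (c.1 g) = _
    rw [← hρ, ← map_sub]
    exact congrArg f h)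

end Cohomology

/-! ### Cyclotomic pro-`p` pairs

A cyclotomic pro-`p` pair is a pro-`p` group `G` with an orientation, that is, a continuous
homomorphism `θ : G →ₜ* ℤ_[p]ˣ`. -/

section Pairs

variable {p : ℕ} [Fact p.Prime] {G : Type*} [Group G] [TopologicalSpace G]

/-- The kernel of an orientation. -/
noncomputable abbrev orientKer (θ : G →ₜ* ℤ_[p]ˣ) : Subgroup G := (θ : G →* ℤ_[p]ˣ).ker

/-- The pair `(G, θ)` is torsion-free if the image of `θ` is. -/
def IsTorsionFreeOrientation (θ : G →ₜ* ℤ_[p]ˣ) : Prop :=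
  GroupIsTorsionFree (θ : G →* ℤ_[p]ˣ).range

/-- The module `ℤ_p(1) / p ^ n`, with its quotient topology. -/
noncomputable abbrev TateMod (p : ℕ) [Fact p.Prime] (n : ℕ) : Type :=
  ℤ_[p] ⧸ Ideal.span {(p : ℤ_[p]) ^ n}

/-- The action of `G` on `ℤ_p(1) / p ^ n`, where `g` acts as multiplication by `θ g`. -/
noncomputable def tateAction (θ : G →ₜ* ℤ_[p]ˣ) (n : ℕ) : Representation ℤ_[p] G (TateMod p n) :=
  ((Module.toModuleEnd ℤ_[p] (S := ℤ_[p]) (TateMod p n)).toMonoidHom.comp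
    (Units.coeHom ℤ_[p])).comp (θ : G →* ℤ_[p]ˣ)

theorem tateAction_apply (θ : G →ₜ* ℤ_[p]ˣ) (n : ℕ) (g : G) (m : TateMod p n) :
    tateAction θ n g m = (θ g : ℤ_[p]) • m := rfl

theorem span_pow_le_span {n : ℕ} (hn : 1 ≤ n) :
    Ideal.span {(p : ℤ_[p]) ^ n} ≤ Ideal.span {(p : ℤ_[p]) ^ 1} :=
  Ideal.span_singleton_le_span_singleton.2 (pow_dvd_pow _ hn)

/-- The canonical epimorphism `ℤ_p(1) / p ^ n → ℤ_p(1) / p`, for `n ≥ 1`. -/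
noncomputable def tateProj {n : ℕ} (hn : 1 ≤ n) : TateMod p n →ₗ[ℤ_[p]] TateMod p 1 :=
  Submodule.factor (span_pow_le_span hn)

theorem continuous_tateProj {n : ℕ} (hn : 1 ≤ n) : Continuous (tateProj (p := p) hn) :=
  continuous_quot_lift _ continuous_quot_mk

/-- The map `H¹(G, ℤ_p(1) / p ^ n) → H¹(G, ℤ_p(1) / p)`, for `n ≥ 1`. -/
noncomputable def kummerMap (θ : G →ₜ* ℤ_[p]ˣ) {n : ℕ} (hn : 1 ≤ n) :
    ContH1 (tateAction θ n) →+ ContH1 (tateAction θ 1) :=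
  contH1Map (tateProj hn) (continuous_tateProj hn) (fun g m => by
    simp only [tateAction_apply, map_smul])

/-- The pair `(G, θ)` is Kummerian if `H¹(G, ℤ_p(1) / p ^ n) → H¹(G, ℤ_p(1) / p)` is surjective
for all `n ≥ 1`. -/
def IsKummerian (θ : G →ₜ* ℤ_[p]ˣ) : Prop :=
  ∀ (n : ℕ) (hn : 1 ≤ n), Function.Surjective (kummerMap θ hn)

theorem isClosed_orientKer (θ : G →ₜ* ℤ_[p]ˣ) : IsClosed (orientKer θ : Set G) :=
  isClosed_singleton.preimage θ.continuous_toFun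

variable [IsTopologicalGroup G]

/-- The subgroup `K(G, θ)`, topologically generated by the elements `h ^ (-θ(g)) * g * h * g⁻¹`
with `g ∈ G` and `h ∈ Ker θ`. -/
noncomputable def kummerSubgroup (θ : G →ₜ* ℤ_[p]ˣ) : Subgroup G :=
  (Subgroup.closure {x : G | ∃ g : G, ∃ h ∈ orientKer θ,
    x = padicPow h (-(θ g : ℤ_[p])) * g * h * g⁻¹}).topologicalClosure

/-- The `θ`-center `Z(G, θ)`, topologically generated by the elements `h ∈ Ker θ` such that
`g * h * g⁻¹ = h ^ θ(g)` for all `g ∈ G`. -/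
noncomputable def orientCenter (θ : G →ₜ* ℤ_[p]ˣ) : Subgroup G :=
  (Subgroup.closure {h : G | h ∈ orientKer θ ∧
    ∀ g : G, g * h * g⁻¹ = padicPow h (θ g : ℤ_[p])}).topologicalClosure

/-- The pair `(G, θ)` is `θ`-abelian if `Z(G, θ) = Ker θ` and `Z(G, θ)` is torsion-free. -/
def IsOrientAbelian (θ : G →ₜ* ℤ_[p]ˣ) : Prop :=
  orientCenter θ = orientKer θ ∧ GroupIsTorsionFree (orientCenter θ)

/-- The orientation of `G ⧸ N` induced by `θ`, for a normal subgroup `N` contained in `Ker θ`. -/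
noncomputable def quotientOrientation (θ : G →ₜ* ℤ_[p]ˣ) (N : Subgroup G) [N.Normal] (hN : N ≤ orientKer θ) :
    G ⧸ N →ₜ* ℤ_[p]ˣ where
  toMonoidHom := QuotientGroup.lift N (θ : G →* ℤ_[p]ˣ) hN
  continuous_toFun := continuous_quot_lift _ θ.continuous_toFun

theorem isClosed_kummerSubgroup (θ : G →ₜ* ℤ_[p]ˣ) : IsClosed (kummerSubgroup θ : Set G) :=
  Subgroup.isClosed_topologicalClosure _

variable [CompactSpace G] [TotallyDisconnectedSpace G] [IsProP p G]

theorem kummerSubgroup_le_orientKer (θ : G →ₜ* ℤ_[p]ˣ) : kummerSubgroup θ ≤ orientKer θ := by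
  refine Subgroup.topologicalClosure_minimal _ ?_ (isClosed_orientKer θ)
  rw [Subgroup.closure_le]
  rintro _ ⟨g, h, hh, rfl⟩
  have h1 := padicPow_mem (isClosed_orientKer θ) hh (-(θ g : ℤ_[p]))
  have h2 : g * h * g⁻¹ ∈ orientKer θ := (MonoidHom.normal_ker _).conj_mem h hh g
  simpa only [mul_assoc, SetLike.mem_coe] using mul_mem h1 h2

instance kummerSubgroup_normal [T2Space G] (θ : G →ₜ* ℤ_[p]ˣ) : (kummerSubgroup θ).Normal := by
  have : (Subgroup.closure {x : G | ∃ g : G, ∃ h ∈ orientKer θ,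
      x = padicPow h (-(θ g : ℤ_[p])) * g * h * g⁻¹}).Normal := by
    rw [← Subgroup.normalizer_eq_top_iff, eq_top_iff, Subgroup.le_normalizer_closure_iff]
    rintro a - _ ⟨g, h, hh, rfl⟩
    refine Subgroup.subset_closure ⟨a * g * a⁻¹, a * h * a⁻¹,
      (MonoidHom.normal_ker _).conj_mem h hh a, ?_⟩
    have hθ : θ (a * g * a⁻¹) = θ g := by
      rw [map_mul, map_mul, mul_right_comm, ← map_mul, mul_inv_cancel, map_one, one_mul]
    rw [hθ, padicPow_conj]
    group
  exact Subgroup.is_normal_topologicalClosure _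

end Pairs

/-! Let A = Ker θ / K. Modulo K, conjugation by g acts on Ker θ as h ↦ h^θ(g). Hence A is abelian,
and every continuous homomorphism A → ℤ_p/p^n is automatically G-equivariant. Condition (iii) adds
nothing to (ii), because the center of the quotient pair is its whole kernel A
(`orientCenter_quotientOrientation`).

The Kummerian condition becomes a statement about characters of A. Cocycles restrict to characters
of A (`exists_restrict_cocycle`). A torsion-free image of θ is procyclic, so Ker θ has a closed
procyclic complement, and characters of A extend to cocycles (`exists_extend_cocycle`). Cocycles
vanishing on Ker θ always lift (`exists_lift_cocycle_of_eq_zero`). So the pair is Kummerian exactly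
when every continuous character A → ℤ_p/p lifts modulo every p^n.

By duality this means that A is torsion-free. If it is, multiplication by p^n embeds A into itself,
and self-injectivity of ℤ/p^(n+1) yields the lifts (`exists_lift_character`). Conversely, the lifts
make p-power torsion elements infinitely p-divisible, hence trivial in a pro-p group
(`nsmul_eq_zero_of_lift_character`). -/

/-! ### Torsion-free compact groups of principal units are procyclic. -/

section PadicUnits

variable {p : ℕ} [Fact p.Prime]

theorem PadicInt.isClosed_dvd (a : ℤ_[p]) : IsClosed {z : ℤ_[p] | a ∣ z} := by
  have h : {z : ℤ_[p] | a ∣ z} = Set.range fun w => a * w := by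
    ext z
    exact ⟨fun ⟨w, hw⟩ => ⟨w, hw.symm⟩, fun ⟨w, hw⟩ => ⟨w, hw.symm⟩⟩
  rw [h]
  exact (isCompact_range (continuous_const_mul a)).isClosed

theorem PadicInt.isOpen_pow_dvd (n : ℕ) : IsOpen {z : ℤ_[p] | (p : ℤ_[p]) ^ n ∣ z} := by
  have h : {z : ℤ_[p] | (p : ℤ_[p]) ^ n ∣ z} = {z | ‖z‖ < (p : ℝ) ^ (-n + 1 : ℤ)} := by
    ext z
    rw [Set.mem_ofPred_eq, Set.mem_ofPred_eq, ← Ideal.mem_span_singleton,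
      ← PadicInt.norm_le_pow_iff_mem_span_pow, PadicInt.norm_le_pow_iff_norm_lt_pow_add_one]
  rw [h]
  exact isOpen_lt continuous_norm continuous_const

theorem PadicInt.isUnit_one_add_mul (e : ℤ_[p]) : IsUnit (1 + (p : ℤ_[p]) * e) := by
  by_contra h
  rw [PadicInt.not_isUnit_iff, PadicInt.norm_lt_one_iff_dvd] at h
  exact PadicInt.prime_p.not_dvd_one ((dvd_add_left (dvd_mul_right _ _)).1 h)

theorem PadicInt.exists_nat_dvd_sub (w : ℤ_[p]) : ∃ j : ℕ, (p : ℤ_[p]) ∣ w - j := by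
  refine ⟨w.appr 1, ?_⟩
  have := PadicInt.appr_spec 1 w
  rwa [pow_one, Ideal.mem_span_singleton] at this

theorem exists_one_add_pow_eq {R : Type*} [CommRing R] (d : R) (j : ℕ) :
    ∃ c, (1 + d) ^ j = 1 + j * d + d ^ 2 * c := by
  induction j with
  | zero => exact ⟨0, by simp⟩
  | succ j ih =>
    obtain ⟨c, hc⟩ := ih
    refine ⟨c + j + d * c, ?_⟩
    rw [pow_succ, hc]
    push_cast
    ring

/-- The condition on `d` under which `1 + d` topologically generates `1 + d * ℤ_p`. -/
def IsProcyclicDepth (d : ℤ_[p]) : Prop :=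
  (p : ℤ_[p]) ∣ d ∧ (p = 2 → 4 ∣ d)

theorem IsProcyclicDepth.of_dvd {d e : ℤ_[p]} (hd : IsProcyclicDepth d) (h : d ∣ e) :
    IsProcyclicDepth e :=
  ⟨hd.1.trans h, fun hp => (hd.2 hp).trans h⟩

/-- In the binomial expansion all terms past `d * p` are divisible by `d * p * p`: for odd `p`
because `p` divides `p.choose 2` and `p ^ 2` divides `d ^ 2`, for `p = 2` because `4 ∣ d`. -/
theorem IsProcyclicDepth.exists_isUnit_pow_sub_one {d : ℤ_[p]} (hd : IsProcyclicDepth d) :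
    ∃ u : ℤ_[p], IsUnit u ∧ (1 + d) ^ p = 1 + d * p * u := by
  rcases (Fact.out : p.Prime).eq_two_or_odd' with rfl | hodd
  · obtain ⟨e, he⟩ := hd.2 rfl
    refine ⟨1 + (2 : ℕ) * e, PadicInt.isUnit_one_add_mul e, ?_⟩
    rw [he]
    push_cast
    ring
  · obtain ⟨e, rfl⟩ := hd.1
    obtain ⟨m, hm⟩ := hodd
    have key : ∀ n : ℕ, ∃ c : ℤ_[p], (1 + (p * e)) ^ n =
        1 + n * (p * e) + (n.choose 2 : ℕ) * (p * e) ^ 2 + (p * e) ^ 3 * c := by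
      intro n
      induction n with
      | zero => exact ⟨0, by simp⟩
      | succ n ih =>
        obtain ⟨c, hc⟩ := ih
        refine ⟨c + n.choose 2 + p * e * c, ?_⟩
        rw [pow_succ, hc, Nat.choose_succ_succ' n 1, Nat.choose_one_right]
        push_cast
        ring
    obtain ⟨c, hc⟩ := key p
    have hch : p.choose 2 = p * m := by
      rw [Nat.choose_two_right, hm]
      simp [Nat.mul_div_assoc]
    refine ⟨1 + p * (m * e + e ^ 2 * c), PadicInt.isUnit_one_add_mul _, ?_⟩
    rw [hc, hch]
    push_cast
    ring

/-- Successive approximation: an exponent `j ≡ w` mod `p` is right to first order, and the error is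
corrected by powers of `(1 + d) ^ p`, which is again one plus an element of procyclic depth. Hence
the induction runs over all `d`. -/
theorem IsProcyclicDepth.exists_pow_dvd_sub (n : ℕ) : ∀ {d : ℤ_[p]}, IsProcyclicDepth d →
    ∀ w : ℤ_[p], ∃ k : ℕ, d * (p : ℤ_[p]) ^ n ∣ (1 + d) ^ k - (1 + d * w) := by
  induction n with
  | zero => exact fun {d} _ w => ⟨0, -w, by ring⟩
  | succ n ih =>
    intro d hd w
    obtain ⟨j, r, hr⟩ := PadicInt.exists_nat_dvd_sub w
    obtain ⟨c, hc⟩ := exists_one_add_pow_eq d j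
    obtain ⟨u, ⟨u, rfl⟩, hu⟩ := hd.exists_isUnit_pow_sub_one
    obtain ⟨e, he⟩ := hd.1
    have hunit : IsUnit ((1 + d) ^ j) := by
      rw [he]
      exact (PadicInt.isUnit_one_add_mul e).pow j
    obtain ⟨v, hv⟩ := hunit
    -- The argument solves `(1 + d) ^ j * (1 + d * p * u * w') = 1 + d * w` for `w'`.
    obtain ⟨k, b, hb⟩ := ih (d := d * p * u) (hd.of_dvd ⟨p * u, by ring⟩)
      (((u⁻¹ : ℤ_[p]ˣ) : ℤ_[p]) * ((v⁻¹ : ℤ_[p]ˣ) : ℤ_[p]) * (r - e * c))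
    refine ⟨j + p * k, (1 + d) ^ j * u * b, ?_⟩
    rw [← hu, ← pow_mul] at hb
    have hw : w = j + p * r := by rw [← hr]; ring
    have h1 : (u : ℤ_[p]) * ((u⁻¹ : ℤ_[p]ˣ) : ℤ_[p]) = 1 := u.mul_inv
    have h2 : (1 + d) ^ j * ((v⁻¹ : ℤ_[p]ˣ) : ℤ_[p]) = 1 := by rw [← hv, v.mul_inv]
    have h3 : (1 + d) ^ (p * k) = d * p * u * p ^ n * b + (1 + d * p * u *
        (((u⁻¹ : ℤ_[p]ˣ) : ℤ_[p]) * ((v⁻¹ : ℤ_[p]ˣ) : ℤ_[p]) * (r - e * c))) := by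
      rw [← hb]; ring
    have h4 : (1 + d) ^ (j + p * k) = (1 + d) ^ j * (d * p * u * p ^ n * b) + (1 + d) ^ j +
        d * p * ((u : ℤ_[p]) * ((u⁻¹ : ℤ_[p]ˣ) : ℤ_[p])) *
          ((1 + d) ^ j * ((v⁻¹ : ℤ_[p]ˣ) : ℤ_[p])) * (r - e * c) := by
      rw [pow_add, h3]; ring
    have h5 : (1 + d) ^ j = 1 + j * d + d * p * e * c := by
      rw [hc]; linear_combination (d * c) * he
    rw [h4, h1, h2, hw]
    linear_combination h5

theorem IsProcyclicDepth.mem_closure_zpowers {t s : ℤ_[p]ˣ}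
    (ht : IsProcyclicDepth ((t : ℤ_[p]) - 1)) (hts : (t : ℤ_[p]) - 1 ∣ s - 1) :
    s ∈ closure (Subgroup.zpowers t : Set ℤ_[p]ˣ) := by
  rw [Units.isOpenEmbedding_val.isInducing.closure_eq_preimage_closure_image, Set.mem_preimage,
    Metric.mem_closure_iff]
  intro ε hε
  obtain ⟨n, hn⟩ := PadicInt.exists_pow_neg_lt p hε
  obtain ⟨w, hw⟩ := hts
  obtain ⟨k, hk⟩ := ht.exists_pow_dvd_sub n w
  refine ⟨_, ⟨t ^ k, Subgroup.npow_mem_zpowers t k, rfl⟩, ?_⟩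
  rw [dist_comm, dist_eq_norm]
  refine lt_of_le_of_lt ?_ hn
  rw [PadicInt.norm_le_pow_iff_mem_span_pow, Ideal.mem_span_singleton]
  have h : ((t ^ k : ℤ_[p]ˣ) : ℤ_[p]) - s = (1 + ((t : ℤ_[p]) - 1)) ^ k -
      (1 + ((t : ℤ_[p]) - 1) * w) := by
    rw [← hw, Units.val_pow_eq_pow_val]; ring
  rw [h]
  exact (dvd_mul_left _ _).trans hk

/-- The group of units of `ℤ_p` that are congruent to `1` modulo `a`. -/
noncomputable def congruenceUnits (a : ℤ_[p]) : Subgroup ℤ_[p]ˣ :=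
  (Units.map (Ideal.Quotient.mk (Ideal.span {a})).toMonoidHom).ker

theorem mem_congruenceUnits {a : ℤ_[p]} {u : ℤ_[p]ˣ} : u ∈ congruenceUnits a ↔ a ∣ u - 1 := by
  rw [← Ideal.mem_span_singleton, ← Ideal.Quotient.eq, map_one, congruenceUnits,
    MonoidHom.mem_ker, Units.ext_iff]
  rfl

theorem isClosed_congruenceUnits (a : ℤ_[p]) : IsClosed (congruenceUnits a : Set ℤ_[p]ˣ) := by
  have : (congruenceUnits a : Set ℤ_[p]ˣ) =
      (fun v : ℤ_[p]ˣ => (v : ℤ_[p]) - 1) ⁻¹' {z | a ∣ z} := Set.ext fun _ => mem_congruenceUnits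
  rw [this]
  exact (PadicInt.isClosed_dvd a).preimage (Units.continuous_val.sub continuous_const)

theorem isOpen_congruenceUnits_pow (n : ℕ) :
    IsOpen (congruenceUnits ((p : ℤ_[p]) ^ n) : Set ℤ_[p]ˣ) := by
  have : (congruenceUnits ((p : ℤ_[p]) ^ n) : Set ℤ_[p]ˣ) =
      (fun v : ℤ_[p]ˣ => (v : ℤ_[p]) - 1) ⁻¹' {z | (p : ℤ_[p]) ^ n ∣ z} :=
    Set.ext fun _ => mem_congruenceUnits
  rw [this]
  exact (PadicInt.isOpen_pow_dvd n).preimage (Units.continuous_val.sub continuous_const)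

theorem dvd_sub_one_of_mem_closure_zpowers {a : ℤ_[p]} {t u : ℤ_[p]ˣ} (ht : a ∣ t - 1)
    (hu : u ∈ closure (Subgroup.zpowers t : Set ℤ_[p]ˣ)) : a ∣ u - 1 :=
  mem_congruenceUnits.1 (closure_minimal (Subgroup.zpowers_le.2 (mem_congruenceUnits.2 ht))
    (isClosed_congruenceUnits a) hu)

theorem PadicInt.dvd_or_mul_dvd (a b : ℤ_[p]) : a ∣ b ∨ b * p ∣ a := by
  by_cases h : a ∣ b
  · exact Or.inl h
  obtain ⟨c, rfl⟩ := (ValuationRing.dvd_total a b).resolve_left h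
  refine Or.inr (mul_dvd_mul_left b ?_)
  rw [← PadicInt.norm_lt_one_iff_dvd, ← PadicInt.not_isUnit_iff]
  rintro ⟨c, rfl⟩
  exact h (Units.mul_right_dvd.2 dvd_rfl)

theorem PadicInt.exists_mem_forall_dvd {S : Set ℤ_[p]} (hS : S.Nonempty) :
    ∃ a ∈ S, ∀ b ∈ S, a ∣ b := by
  obtain ⟨a, ha, hmin⟩ := (wellFounded_dvdNotUnit (α := ℤ_[p])).has_min S hS
  refine ⟨a, ha, fun b hb => ?_⟩
  by_contra h
  obtain ⟨c, hc⟩ := (ValuationRing.dvd_total a b).resolve_left h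
  refine hmin b hb ⟨?_, c, ?_, hc⟩
  · rintro rfl
    exact h (dvd_zero a)
  · rintro ⟨c, rfl⟩
    exact h (hc ▸ Units.mul_right_dvd.2 dvd_rfl)

theorem four_dvd_mul_of_two_adic_units {u v : ℤ_[2]ˣ} (hu : ¬ 4 ∣ (u : ℤ_[2]) - 1)
    (hv : ¬ 4 ∣ (v : ℤ_[2]) - 1) (hu2 : 2 ∣ (u : ℤ_[2]) - 1) (hv2 : 2 ∣ (v : ℤ_[2]) - 1) :
    4 ∣ ((u * v : ℤ_[2]ˣ) : ℤ_[2]) - 1 := by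
  obtain ⟨a, ha⟩ := hu2
  obtain ⟨b, hb⟩ := hv2
  have odd : ∀ {z c : ℤ_[2]}, ¬ 4 ∣ z - 1 → z - 1 = 2 * c → ∃ e, c = 1 + 2 * e := by
    intro z c hz hc
    obtain ⟨j, r, hr⟩ := PadicInt.exists_nat_dvd_sub c
    rcases Nat.even_or_odd' j with ⟨m, rfl | rfl⟩
    · refine absurd ⟨m + r, ?_⟩ hz
      push_cast at hr
      linear_combination hc + 2 * hr
    · refine ⟨m + r, ?_⟩
      push_cast at hr
      linear_combination hr
  obtain ⟨e, rfl⟩ := odd hu ha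
  obtain ⟨f, rfl⟩ := odd hv hb
  refine ⟨2 + 3 * e + 3 * f + 4 * e * f, ?_⟩
  rw [Units.val_mul]
  linear_combination (1 + 2 * (1 + 2 * f)) * ha + (u : ℤ_[2]) * hb

/-- A compact torsion-free group of principal `p`-adic units is procyclic. -/
theorem exists_mem_le_closure_zpowers {T : Subgroup ℤ_[p]ˣ} (hT : IsCompact (T : Set ℤ_[p]ˣ))
    (htf : ∀ u ∈ T, IsOfFinOrder u → u = 1) (hp : ∀ u ∈ T, (p : ℤ_[p]) ∣ u - 1) :
    ∃ t ∈ T, (T : Set ℤ_[p]ˣ) ⊆ closure (Subgroup.zpowers t : Set ℤ_[p]ˣ) := by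
  -- Choose `t` with `t - 1` of least valuation among the elements of procyclic depth; the element
  -- `1` makes the set nonempty.
  obtain ⟨_, ⟨t, ⟨ht, htd⟩, rfl⟩, hmin⟩ := PadicInt.exists_mem_forall_dvd
    (S := (fun u : ℤ_[p]ˣ => (u : ℤ_[p]) - 1) '' {u | u ∈ T ∧ IsProcyclicDepth ((u : ℤ_[p]) - 1)})
    ⟨0, 1, ⟨T.one_mem, by simp [IsProcyclicDepth]⟩, by simp⟩
  have hgood : ∀ u ∈ T, IsProcyclicDepth ((u : ℤ_[p]) - 1) →
      u ∈ closure (Subgroup.zpowers t : Set ℤ_[p]ˣ) :=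
    fun u hu hud => htd.mem_closure_zpowers (hmin _ ⟨u, ⟨hu, hud⟩, rfl⟩)
  by_cases hall : ∀ u ∈ T, IsProcyclicDepth ((u : ℤ_[p]) - 1)
  · exact ⟨t, ht, fun u hu => hgood u hu (hall u hu)⟩
  push Not at hall
  -- What remains is `p = 2` with some `y ≡ 3` mod 4 in `T`; any such `y` turns out to be a
  -- generator.
  obtain ⟨y, hy, hyd⟩ := hall
  obtain ⟨rfl, hy4⟩ : p = 2 ∧ ¬ (4 : ℤ_[p]) ∣ y - 1 := by
    simp only [IsProcyclicDepth, hp y hy, true_and, Classical.not_imp] at hyd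
    exact hyd
  have good_iff : ∀ u ∈ T, IsProcyclicDepth ((u : ℤ_[2]) - 1) ↔ (4 : ℤ_[2]) ∣ u - 1 :=
    fun u hu => ⟨fun h => h.2 rfl, fun h => ⟨hp u hu, fun _ => h⟩⟩
  have hmul : ∀ u ∈ T, ¬ (4 : ℤ_[2]) ∣ u - 1 → IsProcyclicDepth (((y * u : ℤ_[2]ˣ) : ℤ_[2]) - 1) :=
    fun u hu hu4 => (good_iff _ (T.mul_mem hy hu)).2 (four_dvd_mul_of_two_adic_units hy4 hu4
      (by simpa using hp y hy) (by simpa using hp u hu))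
  have hyy := hmul y hy hy4
  have htcl : closure (Subgroup.zpowers t : Set ℤ_[2]ˣ) ⊆ T :=
    closure_minimal (Subgroup.zpowers_le.2 ht) hT.isClosed
  have htcl4 : ∀ w ∈ closure (Subgroup.zpowers t : Set ℤ_[2]ˣ), (4 : ℤ_[2]) ∣ w - 1 :=
    fun w hw => dvd_sub_one_of_mem_closure_zpowers (htd.2 rfl) hw
  -- Otherwise `y * y` lies in the closure of the powers of `t * t`, so `y * y = w * w` with `w` in
  -- the closure of the powers of `t`. Torsion-freeness gives `y = w`, which is `1` mod 4.
  have hty : ((y * y : ℤ_[2]ˣ) : ℤ_[2]) - 1 ∣ t - 1 := by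
    refine (PadicInt.dvd_or_mul_dvd _ _).resolve_right fun hdvd => hy4 ?_
    obtain ⟨u, hu, hpow⟩ := htd.exists_isUnit_pow_sub_one
    have hmem : y * y ∈ closure (Subgroup.zpowers (t * t) : Set ℤ_[2]ˣ) := by
      have htt : ((t * t : ℤ_[2]ˣ) : ℤ_[2]) - 1 = (t - 1) * (2 : ℕ) * u := by
        rw [Units.val_mul]
        linear_combination hpow
      refine IsProcyclicDepth.mem_closure_zpowers ?_ ?_
      · rw [htt]
        exact htd.of_dvd ⟨(2 : ℕ) * u, by ring⟩
      · rw [htt]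
        exact hu.mul_right_dvd.2 hdvd
    have hsub : closure (Subgroup.zpowers (t * t) : Set ℤ_[2]ˣ) ⊆
        (fun w => w * w) '' closure (Subgroup.zpowers t : Set ℤ_[2]ˣ) := by
      refine closure_minimal ?_ ((hT.of_isClosed_subset isClosed_closure htcl).image
        (continuous_id.mul continuous_id)).isClosed
      rintro _ ⟨k, rfl⟩
      exact ⟨t ^ k, subset_closure ⟨k, rfl⟩, (mul_zpow t t k).symm⟩
    obtain ⟨w, hw, hwy⟩ := hsub hmem
    have h1 : y * w⁻¹ = 1 := by
      refine htf _ (T.mul_mem hy (T.inv_mem (htcl hw))) (isOfFinOrder_iff_pow_eq_one.2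
        ⟨2, two_pos, ?_⟩)
      rw [mul_pow, inv_pow, pow_two, pow_two, ← hwy, mul_inv_cancel]
    rw [mul_inv_eq_one.1 h1]
    exact htcl4 w hw
  have ht_mem : t ∈ closure (Subgroup.zpowers y : Set ℤ_[2]ˣ) :=
    closure_mono (Subgroup.zpowers_le.2 ((Subgroup.zpowers y).mul_mem
      (Subgroup.mem_zpowers y) (Subgroup.mem_zpowers y))) (hyy.mem_closure_zpowers hty)
  have hsubset : closure (Subgroup.zpowers t : Set ℤ_[2]ˣ) ⊆
      (Subgroup.zpowers y).topologicalClosure :=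
    closure_minimal (Subgroup.zpowers_le.2 ht_mem) isClosed_closure
  refine ⟨y, hy, fun u hu => ?_⟩
  by_cases hu4 : (4 : ℤ_[2]) ∣ u - 1
  · exact hsubset (hgood u hu ((good_iff u hu).2 hu4))
  · have := (Subgroup.zpowers y).topologicalClosure.mul_mem
      ((Subgroup.zpowers y).topologicalClosure.inv_mem
        (subset_closure (Subgroup.mem_zpowers y)))
      (hsubset (hgood _ (T.mul_mem hy hu) (hmul u hu hu4)))
    rwa [inv_mul_cancel_left] at this

end PadicUnits

/-! ### Self-injectivity of ℤ_p/p^n. -/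

section TateModules

variable {p : ℕ} [Fact p.Prime]

instance TateMod.discreteTopology (n : ℕ) : DiscreteTopology (TateMod p n) :=
  QuotientAddGroup.discreteTopology (N := (Ideal.span {(p : ℤ_[p]) ^ n}).toAddSubgroup) (by
    convert PadicInt.isOpen_pow_dvd (p := p) n using 1
    ext z
    exact Ideal.mem_span_singleton)

theorem TateMod.mk_eq_zero {n : ℕ} {z : ℤ_[p]} :
    (Submodule.Quotient.mk z : TateMod p n) = 0 ↔ (p : ℤ_[p]) ^ n ∣ z := by
  rw [Submodule.Quotient.mk_eq_zero, Ideal.mem_span_singleton]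

theorem TateMod.nsmul_mk {n : ℕ} (k : ℕ) (z : ℤ_[p]) :
    k • (Submodule.Quotient.mk z : TateMod p n) = Submodule.Quotient.mk ((k : ℤ_[p]) * z) := by
  rw [← Submodule.Quotient.mk_smul, nsmul_eq_mul]

theorem TateMod.pow_nsmul {n : ℕ} (m : TateMod p n) : p ^ n • m = 0 := by
  obtain ⟨z, rfl⟩ := Submodule.Quotient.mk_surjective _ m
  rw [TateMod.nsmul_mk, TateMod.mk_eq_zero, Nat.cast_pow]
  exact dvd_mul_right _ _

theorem TateMod.smul_eq_zero_of_pow_dvd {n : ℕ} {z : ℤ_[p]} (hz : (p : ℤ_[p]) ^ n ∣ z)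
    (m : TateMod p n) : z • m = 0 := by
  obtain ⟨w, rfl⟩ := Submodule.Quotient.mk_surjective _ m
  rw [← Submodule.Quotient.mk_smul, TateMod.mk_eq_zero, smul_eq_mul]
  exact hz.mul_right w

theorem TateMod.exists_eq_pow_nsmul {k j : ℕ} {m : TateMod p (k + j)} (hm : p ^ k • m = 0) :
    ∃ m', m = p ^ j • m' := by
  obtain ⟨z, rfl⟩ := Submodule.Quotient.mk_surjective _ m
  rw [TateMod.nsmul_mk, TateMod.mk_eq_zero, pow_add, Nat.cast_pow] at hm
  obtain ⟨w, rfl⟩ := (mul_dvd_mul_iff_left (pow_ne_zero k PadicInt.prime_p.ne_zero)).1 hm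
  exact ⟨Submodule.Quotient.mk w, by rw [TateMod.nsmul_mk, Nat.cast_pow]⟩

theorem tateProj_mk {n : ℕ} (hn : 1 ≤ n) (z : ℤ_[p]) :
    tateProj hn (Submodule.Quotient.mk z) = Submodule.Quotient.mk z := rfl

theorem tateProj_surjective {n : ℕ} (hn : 1 ≤ n) : Function.Surjective (tateProj (p := p) hn) := by
  intro m
  obtain ⟨z, rfl⟩ := Submodule.Quotient.mk_surjective _ m
  exact ⟨Submodule.Quotient.mk z, rfl⟩

/-- Multiplication by `p ^ n` as an embedding of `ℤ_p / p` into `ℤ_p / p ^ (n + 1)`. -/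
noncomputable def tateIncl (n : ℕ) : TateMod p 1 →ₗ[ℤ_[p]] TateMod p (n + 1) :=
  Submodule.liftQ _ ((p : ℤ_[p]) ^ n • Submodule.mkQ _) (by
    rw [Ideal.span_singleton_le_iff_mem, LinearMap.mem_ker, LinearMap.smul_apply,
      Submodule.mkQ_apply, ← Submodule.Quotient.mk_smul, TateMod.mk_eq_zero, smul_eq_mul, pow_one,
      pow_succ])

theorem tateIncl_tateProj {n : ℕ} (m : TateMod p (n + 1)) :
    tateIncl n (tateProj n.succ_pos m) = p ^ n • m := by
  obtain ⟨z, rfl⟩ := Submodule.Quotient.mk_surjective _ m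
  rw [TateMod.nsmul_mk, tateProj_mk, Nat.cast_pow]
  rfl

theorem tateIncl_injective (n : ℕ) : Function.Injective (tateIncl (p := p) n) := by
  rw [injective_iff_map_eq_zero]
  intro m hm
  obtain ⟨m, rfl⟩ := tateProj_surjective n.succ_pos m
  obtain ⟨z, rfl⟩ := Submodule.Quotient.mk_surjective _ m
  rw [tateIncl_tateProj, TateMod.nsmul_mk, TateMod.mk_eq_zero, pow_succ, Nat.cast_pow] at hm
  rw [tateProj_mk, TateMod.mk_eq_zero, pow_one]
  exact (mul_dvd_mul_iff_left (pow_ne_zero n PadicInt.prime_p.ne_zero)).1 hm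

/-- An ideal of ℤ/p^n is generated by some p^k. The image of p^k is killed by p^(n-k), so it is p^k
times some `m`, and 1 ↦ `m` extends the map. -/
theorem TateMod.baer (n : ℕ) [Module (ZMod (p ^ n)) (TateMod p n)] :
    Module.Baer (ZMod (p ^ n)) (TateMod p n) := by
  intro I g
  obtain ⟨d, hd⟩ := IsPrincipalIdealRing.principal (I.comap (Int.castRingHom (ZMod (p ^ n))))
  have hmem : ∀ z : ℤ, (z : ZMod (p ^ n)) ∈ I ↔ (d.natAbs : ℤ) ∣ z := fun z => by
    rw [Int.natAbs_dvd, ← Ideal.mem_span_singleton, ← Ideal.submodule_span_eq, ← hd]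
    rfl
  have hdvd : d.natAbs ∣ p ^ n := by
    rw [← Int.natCast_dvd_natCast, ← hmem, Int.cast_natCast, ZMod.natCast_self]
    exact I.zero_mem
  obtain ⟨k, hk, hdk⟩ := (Nat.dvd_prime_pow Fact.out).1 hdvd
  obtain ⟨j, rfl⟩ := Nat.exists_eq_add_of_le' hk
  rw [hdk] at hmem
  have hpk : ((p ^ k : ℕ) : ZMod (p ^ (j + k))) ∈ I := by
    have := (hmem (p ^ k : ℕ)).2 dvd_rfl
    rwa [Int.cast_natCast] at this
  obtain ⟨m, hm⟩ := TateMod.exists_eq_pow_nsmul (k := j) (j := k) (m := g ⟨_, hpk⟩) (by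
    rw [← map_nsmul, ← map_zero g]
    congr 1
    ext
    rw [Submodule.coe_smul_of_tower, nsmul_eq_mul, ← Nat.cast_mul, ← pow_add]
    exact ZMod.natCast_self _)
  refine ⟨LinearMap.toSpanSingleton _ _ m, fun x hx => ?_⟩
  obtain ⟨z, rfl⟩ := ZMod.intCast_surjective x
  obtain ⟨w, rfl⟩ := (hmem z).1 hx
  have : (⟨_, hx⟩ : I) = (w : ZMod (p ^ (j + k))) • (⟨_, hpk⟩ : I) := by
    ext
    simp [mul_comm]
  rw [this, map_smul, hm, LinearMap.toSpanSingleton_apply, ← Nat.cast_smul_eq_nsmul (ZMod (p ^ (j + k))),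
    smul_smul]
  congr 1
  push_cast
  ring

/-- Homomorphisms into `ℤ_p / p ^ n` extend along embeddings of groups killed by `p ^ n`. -/
theorem TateMod.exists_extension {n : ℕ} {X Y : Type*} [AddCommGroup X] [AddCommGroup Y]
    (hX : ∀ x : X, p ^ n • x = 0) (hY : ∀ y : Y, p ^ n • y = 0) {f : X →+ Y}
    (hf : Function.Injective f) (g : X →+ TateMod p n) :
    ∃ h : Y →+ TateMod p n, ∀ x, h (f x) = g x := by
  let := AddCommGroup.zmodModule hX
  let := AddCommGroup.zmodModule hY
  let := AddCommGroup.zmodModule (TateMod.pow_nsmul (p := p) (n := n))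
  obtain ⟨h, hh⟩ := (TateMod.baer n).extension_property (f.toZModLinearMap (p ^ n)) hf
    (g.toZModLinearMap (p ^ n))
  exact ⟨h.toAddMonoidHom, fun x => LinearMap.congr_fun hh x⟩

theorem TateMod.exists_ne_zero {X : Type*} [AddCommGroup X] (hX : ∀ x : X, p • x = 0) {x : X}
    (hx : x ≠ 0) : ∃ f : X →+ TateMod p 1, f x ≠ 0 := by
  let : Module (ZMod p) X := AddCommGroup.zmodModule hX
  let : Module (ZMod p) (TateMod p 1) :=
    AddCommGroup.zmodModule fun m => by simpa using TateMod.pow_nsmul m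
  rw [Ne, ← Module.forall_dual_apply_eq_zero_iff (ZMod p), not_forall] at hx
  obtain ⟨f, hf⟩ := hx
  have hm : (Submodule.Quotient.mk 1 : TateMod p 1) ≠ 0 := by
    rw [Ne, TateMod.mk_eq_zero, pow_one]
    exact PadicInt.prime_p.not_dvd_one
  exact ⟨((LinearMap.toSpanSingleton (ZMod p) (TateMod p 1) (Submodule.Quotient.mk 1)).comp
    f).toAddMonoidHom, fun h => hm ((IsUnit.mk0 _ hf).smul_eq_zero.1 h)⟩

end TateModules

/-! ### Lifting characters versus torsion in profinite abelian groups. -/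

section Duality

variable {p : ℕ} [Fact p.Prime] {A : Type*} [AddCommGroup A] [TopologicalSpace A]
  [NonarchimedeanAddGroup A]

theorem AddSubgroup.isOpen_sup_left {V : OpenAddSubgroup A} (H : AddSubgroup A) :
    IsOpen ((V.toAddSubgroup ⊔ H : AddSubgroup A) : Set A) :=
  AddSubgroup.isOpen_mono le_sup_left V.isOpen'

theorem AddMonoidHom.continuous_comp_mk_of_isOpen {B : Type*} [AddCommGroup B] [TopologicalSpace B]
    {U : AddSubgroup A} (hU : IsOpen (U : Set A)) (f : A ⧸ U →+ B) :
    Continuous fun a : A => f (QuotientAddGroup.mk a) := by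
  have := QuotientAddGroup.discreteTopology hU
  exact (continuous_of_discreteTopology (f := f)).comp continuous_quot_mk

variable [CompactSpace A] [T2Space A]

/-- A character of order `p` of a torsion-free profinite abelian group lifts to characters of
order `p ^ (n + 1)`. -/
theorem exists_lift_character (htf : ∀ a : A, ∀ m : ℕ, 0 < m → m • a = 0 → a = 0) (n : ℕ)
    (φ : A →+ TateMod p 1) (hφ : Continuous φ) :
    ∃ ψ : A →+ TateMod p (n + 1), Continuous ψ ∧ ∀ a, tateProj n.succ_pos (ψ a) = φ a := by
  have hp : 0 < p := (Fact.out : p.Prime).pos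
  let j : A →+ A := nsmulAddMonoidHom (p ^ n)
  -- Torsion-freeness and compactness enter here: the open kernel of `φ` is then cut out by an open
  -- condition on `p ^ n • a`.
  have hj : Topology.IsClosedEmbedding j := (continuous_nsmul (p ^ n)).isClosedEmbedding
    ((injective_iff_map_eq_zero j).2 fun a ha => htf a _ (pow_pos hp n) ha)
  obtain ⟨O, hO, hOker⟩ := hj.isInducing.isOpen_iff.1 ((isOpen_discrete {0}).preimage hφ)
  have hOφ : ∀ a, p ^ n • a ∈ O ↔ φ a = 0 := fun a => Set.ext_iff.1 hOker a
  obtain ⟨V, hV⟩ := NonarchimedeanAddGroup.is_nonarchimedean O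
    (hO.mem_nhds (by simpa using (hOφ 0).2 (map_zero φ)))
  let P : AddSubgroup A := (nsmulAddMonoidHom (p ^ (n + 1))).range
  let U : AddSubgroup A := V.toAddSubgroup ⊔ P
  have hUφ : ∀ a, p ^ n • a ∈ U → φ a = 0 := by
    intro a ha
    obtain ⟨v, hv, _, ⟨b, rfl⟩, hab⟩ := AddSubgroup.mem_sup.1 ha
    have h1 : v = p ^ n • (a - p • b) := by
      rw [nsmul_sub, ← hab, smul_smul, ← pow_succ, nsmulAddMonoidHom_apply, add_sub_cancel_right]
    have h2 := (hOφ _).1 (h1 ▸ hV hv)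
    rwa [map_sub, map_nsmul, show p • φ b = 0 by
      simpa using TateMod.pow_nsmul (φ b), sub_zero] at h2
  have hPU : ∀ a, p ^ (n + 1) • a ∈ U := fun a => AddSubgroup.mem_sup_right ⟨a, rfl⟩
  -- Multiplication by `p ^ n` embeds `A ⧸ W` into `A ⧸ U`. Extending `tateIncl n ∘ φ` along it
  -- gives `ψ` with `ψ (p ^ n • a) = tateIncl n (φ a)`, and injectivity of `tateIncl n` recovers
  -- `φ`.
  let W : AddSubgroup A := U.comap j
  let f : A ⧸ W →+ A ⧸ U := QuotientAddGroup.map W U j le_rfl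
  have hf : Function.Injective f := by
    rw [injective_iff_map_eq_zero]
    intro x hx
    obtain ⟨a, rfl⟩ := QuotientAddGroup.mk_surjective x
    exact (QuotientAddGroup.eq_zero_iff (N := W) a).2
      ((QuotientAddGroup.eq_zero_iff (N := U) (p ^ n • a)).1 hx)
  have hWφ : W ≤ ((tateIncl n).toAddMonoidHom.comp φ).ker := fun a ha => by
    simp [AddMonoidHom.mem_ker, hUφ a ha]
  obtain ⟨h, hh⟩ := TateMod.exists_extension (p := p) (n := n + 1) (X := A ⧸ W) (Y := A ⧸ U)
    (fun x => by
      obtain ⟨a, rfl⟩ := QuotientAddGroup.mk_surjective x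
      rw [← QuotientAddGroup.mk_nsmul, QuotientAddGroup.eq_zero_iff]
      change p ^ n • p ^ (n + 1) • a ∈ U
      exact U.nsmul_mem (hPU a) _)
    (fun x => by
      obtain ⟨a, rfl⟩ := QuotientAddGroup.mk_surjective x
      rw [← QuotientAddGroup.mk_nsmul, QuotientAddGroup.eq_zero_iff]
      exact hPU a)
    hf (QuotientAddGroup.lift W _ hWφ)
  refine ⟨h.comp (QuotientAddGroup.mk' U),
    AddMonoidHom.continuous_comp_mk_of_isOpen (AddSubgroup.isOpen_sup_left P) h, fun a => ?_⟩
  apply tateIncl_injective n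
  rw [tateIncl_tateProj, ← map_nsmul]
  exact hh (QuotientAddGroup.mk a)

/-- Characters of order `p` separate points modulo multiples of `p`. -/
theorem exists_character_ne_zero {a : A} (ha : ∀ b : A, a ≠ p • b) :
    ∃ φ : A →+ TateMod p 1, Continuous φ ∧ φ a ≠ 0 := by
  let P : AddSubgroup A := (nsmulAddMonoidHom p).range
  have hP : IsClosed (P : Set A) := (isCompact_range (continuous_nsmul p)).isClosed
  have haP : a ∉ P := fun ⟨b, hb⟩ => ha b hb.symm
  obtain ⟨V, hV⟩ := NonarchimedeanAddGroup.is_nonarchimedean _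
    ((hP.isOpen_compl.preimage ((continuous_const (y := a)).sub continuous_id)).mem_nhds
      (show a - 0 ∈ (P : Set A)ᶜ by simpa using haP))
  let U : AddSubgroup A := V.toAddSubgroup ⊔ P
  have haU : a ∉ U := fun h => by
    obtain ⟨v, hv, x, hx, hvx⟩ := AddSubgroup.mem_sup.1 h
    exact hV hv (by
      change a - v ∈ P
      rw [← hvx, add_sub_cancel_left]
      exact hx)
  obtain ⟨f, hf⟩ := TateMod.exists_ne_zero (p := p) (X := A ⧸ U) (fun x => by
    obtain ⟨b, rfl⟩ := QuotientAddGroup.mk_surjective x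
    rw [← QuotientAddGroup.mk_nsmul, QuotientAddGroup.eq_zero_iff]
    exact AddSubgroup.mem_sup_right ⟨b, rfl⟩) (mt (QuotientAddGroup.eq_zero_iff a).1 haU)
  exact ⟨f.comp (QuotientAddGroup.mk' U),
    AddMonoidHom.continuous_comp_mk_of_isOpen (AddSubgroup.isOpen_sup_left P) f, hf⟩

/-- If all characters of order `p` of a pro-`p` abelian group lift to characters of order `p ^ n`
for all `n`, then the group is torsion-free. -/
theorem nsmul_eq_zero_of_lift_character
    (hA : ∀ U : AddSubgroup A, IsOpen (U : Set A) → ∃ j : ℕ, ∀ a : A, p ^ j • a ∈ U)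
    (hlift : ∀ φ : A →+ TateMod p 1, Continuous φ → ∀ n : ℕ, ∃ ψ : A →+ TateMod p (n + 1),
      ∀ a, tateProj n.succ_pos (ψ a) = φ a)
    (a : A) (m : ℕ) (hm : 0 < m) (ha : m • a = 0) : a = 0 := by
  have hzero : ∀ a : A, (∀ U : AddSubgroup A, IsOpen (U : Set A) → a ∈ U) → a = 0 := by
    intro a ha
    by_contra hne
    obtain ⟨V, hV⟩ := NonarchimedeanAddGroup.is_nonarchimedean {a}ᶜ
      (isOpen_compl_singleton.mem_nhds (Ne.symm hne))
    exact hV (ha V.toAddSubgroup V.isOpen') rfl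
  -- If `a` is not a multiple of `p`, some `φ` has `φ a ≠ 0`. A lift `ψ` modulo `p ^ (k + 1)` has `p
  -- ^ k • ψ a = 0`, so `ψ a` is a multiple of `p` and `φ a = 0`.
  have hdiv : ∀ (k : ℕ) (a : A), p ^ k • a = 0 → ∃ b, a = p • b := by
    intro k a ha
    by_contra! hne
    obtain ⟨φ, hφ, hφa⟩ := exists_character_ne_zero hne
    obtain ⟨ψ, hψ⟩ := hlift φ hφ k
    obtain ⟨m', hm'⟩ := TateMod.exists_eq_pow_nsmul (k := k) (j := 1) (m := ψ a)
      (by rw [← map_nsmul, ha, map_zero])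
    refine hφa ?_
    rw [← hψ, hm', map_nsmul, TateMod.pow_nsmul]
  have hdivpow : ∀ (j k : ℕ) (a : A), p ^ k • a = 0 → ∃ b, a = p ^ j • b := by
    intro j
    induction j with
    | zero => exact fun k a _ => ⟨a, by simp⟩
    | succ j ih =>
      intro k a ha
      obtain ⟨b, rfl⟩ := hdiv k a ha
      obtain ⟨c, rfl⟩ := ih (k + 1) b (by rw [pow_succ, mul_smul, ha])
      exact ⟨c, by rw [smul_smul, pow_succ']⟩
  have hprim : ∀ (k : ℕ) (a : A), p ^ k • a = 0 → a = 0 := by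
    refine fun k a ha => hzero a fun U hU => ?_
    obtain ⟨j, hj⟩ := hA U hU
    obtain ⟨b, rfl⟩ := hdivpow j k a ha
    exact hj b
  obtain ⟨k, r, hr, rfl⟩ := Nat.exists_eq_pow_mul_and_not_dvd hm.ne' p (Fact.out : p.Prime).ne_one
  rw [mul_smul] at ha
  have hra := hprim k _ ha
  -- The prime-to-`p` part `r` of `m` is invertible modulo the exponent of `A ⧸ U`.
  refine hzero a fun U hU => ?_
  obtain ⟨j, hj⟩ := hA U hU
  have hcop : IsCoprime (r : ℤ) ((p ^ j : ℕ) : ℤ) := Nat.isCoprime_iff_coprime.2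
    (((Nat.Prime.coprime_iff_not_dvd Fact.out).2 hr).symm.pow_right j)
  obtain ⟨u, v, huv⟩ := hcop
  have : a = v • (p ^ j • a) := by
    rw [← natCast_zsmul, smul_smul]
    calc a = (u * r + v * (p ^ j : ℕ)) • a := by rw [huv, one_smul]
      _ = _ := by rw [add_smul, mul_smul u, natCast_zsmul, hra, smul_zero, zero_add]
  rw [this]
  exact U.zsmul_mem (hj a) v

end Duality

/-! ### Calculus of `p`-adic powers. -/

section ProP

variable {p : ℕ} [Fact p.Prime] {G : Type*} [Group G] [TopologicalSpace G] [IsTopologicalGroup G]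
  [CompactSpace G] [IsProP p G]

theorem IsProP.exists_forall_pow_mem (p : ℕ) [Fact p.Prime] [IsProP p G] {U : Subgroup G}
    [U.Normal] (hU : IsOpen (U : Set G)) : ∃ j : ℕ, ∀ g : G, g ^ p ^ j ∈ U := by
  have := QuotientGroup.discreteTopology hU
  have : Finite (G ⧸ U) := finite_of_compact_of_discrete
  obtain ⟨j, hj⟩ := IsPGroup.iff_card.1 (IsProP.isPGroup_quotient (p := p) U hU)
  refine ⟨j, fun g => ?_⟩
  rw [← QuotientGroup.eq_one_iff, QuotientGroup.mk_pow, ← hj, pow_card_eq_one']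

variable [TotallyDisconnectedSpace G]

theorem IsProP.tendsto_pow_of_dvd (h : G) {a : ℕ → ℕ} (ha : ∀ k, p ^ k ∣ a k) :
    Filter.Tendsto (fun k => h ^ a k) Filter.atTop (nhds 1) := by
  rw [Filter.tendsto_def]
  intro s hs
  obtain ⟨W, hWs, hW, hW1⟩ := mem_nhds_iff.1 hs
  obtain ⟨U, hU⟩ := ProfiniteGrp.exist_openNormalSubgroup_sub_open_nhds_of_one hW hW1
  obtain ⟨j, hj⟩ := IsProP.exists_forall_pow_mem p (U := U.toSubgroup) U.isOpen'
  filter_upwards [Filter.eventually_ge_atTop j] with k hk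
  obtain ⟨c, hc⟩ := (pow_dvd_pow p hk).trans (ha k)
  rw [Set.mem_preimage, hc, pow_mul]
  exact hWs (hU (U.toSubgroup.pow_mem (hj h) c))

theorem padicPow_neg [T2Space G] (h : G) (z : ℤ_[p]) : padicPow h (-z) = (padicPow h z)⁻¹ := by
  rw [eq_inv_iff_mul_eq_one]
  refine tendsto_nhds_unique ((tendsto_padicPow h (-z)).mul (tendsto_padicPow h z)) ?_
  simp_rw [← pow_add]
  refine IsProP.tendsto_pow_of_dvd (p := p) h fun k => ?_
  have h1 := PadicInt.appr_spec k z
  have h2 := PadicInt.appr_spec k (-z)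
  rw [Ideal.mem_span_singleton] at h1 h2
  have h3 := (dvd_add h1 h2).neg_right
  rw [show -(z - z.appr k + (-z - (-z).appr k)) = (((-z).appr k + z.appr k : ℕ) : ℤ_[p]) by
    push_cast; ring] at h3
  have h4 := (PadicInt.pow_p_dvd_int_iff k (((-z).appr k + z.appr k : ℕ) : ℤ)).1
    (by rwa [Int.cast_natCast])
  exact_mod_cast h4

theorem padicPow_mk [T2Space G] (N : Subgroup G) [N.Normal] (hN : IsClosed (N : Set G)) (h : G)
    (z : ℤ_[p]) : padicPow (QuotientGroup.mk (s := N) h) z = QuotientGroup.mk (padicPow h z) := by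
  -- Closedness makes the quotient Hausdorff, so that `limUnder` is the limit found by continuity.
  have : IsClosed (N : Set G) := hN
  exact ((QuotientGroup.continuous_mk.tendsto _).comp (tendsto_padicPow h z)).limUnder_eq

end ProP

/-! ### Conditions (ii) and (iii) as the absence of roots of K outside K. -/

section Abelian

variable {p : ℕ} [Fact p.Prime] {G : Type*} [Group G] [TopologicalSpace G] [IsTopologicalGroup G]
  [CompactSpace G] [T2Space G] [TotallyDisconnectedSpace G] [IsProP p G]

theorem mul_padicPow_neg_mem_kummerSubgroup (θ : G →ₜ* ℤ_[p]ˣ) (g : G) {h : G}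
    (hh : h ∈ orientKer θ) :
    (padicPow h (θ g : ℤ_[p]))⁻¹ * (g * h * g⁻¹) ∈ kummerSubgroup θ := by
  rw [← padicPow_neg]
  exact Subgroup.le_topologicalClosure _ (Subgroup.subset_closure ⟨g, h, hh, by group⟩)

/-- The generators of K are exactly the obstructions to `g * h * g⁻¹ = h ^ θ(g)`, and `p`-adic
powers pass to the quotient; so each element of the kernel is itself one of the generators of the
center. -/
theorem orientCenter_quotientOrientation (θ : G →ₜ* ℤ_[p]ˣ) :
    orientCenter (quotientOrientation θ (kummerSubgroup θ) (kummerSubgroup_le_orientKer θ)) =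
      orientKer (quotientOrientation θ (kummerSubgroup θ) (kummerSubgroup_le_orientKer θ)) := by
  refine le_antisymm (Subgroup.topologicalClosure_minimal _ ?_ ?_) fun x hx => ?_
  · rw [Subgroup.closure_le]
    exact fun x hx => hx.1
  · exact isClosed_orientKer _
  · refine Subgroup.le_topologicalClosure _ (Subgroup.subset_closure ⟨hx, fun y => ?_⟩)
    obtain ⟨h, rfl⟩ := QuotientGroup.mk_surjective x
    obtain ⟨g, rfl⟩ := QuotientGroup.mk_surjective y
    change _ = padicPow (QuotientGroup.mk h) (θ g : ℤ_[p])
    rw [padicPow_mk _ (isClosed_kummerSubgroup θ), ← QuotientGroup.mk_inv, ← QuotientGroup.mk_mul,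
      ← QuotientGroup.mk_mul, eq_comm, QuotientGroup.eq]
    exact mul_padicPow_neg_mem_kummerSubgroup θ g hx

theorem isOrientAbelian_quotientOrientation_iff (θ : G →ₜ* ℤ_[p]ˣ) :
    IsOrientAbelian (quotientOrientation θ (kummerSubgroup θ) (kummerSubgroup_le_orientKer θ)) ↔
      ∀ h ∈ orientKer θ, ∀ m : ℕ, 0 < m → h ^ m ∈ kummerSubgroup θ → h ∈ kummerSubgroup θ := by
  rw [IsOrientAbelian, orientCenter_quotientOrientation]
  simp only [true_and, GroupIsTorsionFree, isOfFinOrder_iff_pow_eq_one]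
  constructor
  · intro H h hh m hm hmem
    have := H ⟨QuotientGroup.mk h, hh⟩ ⟨m, hm, Subtype.ext ((QuotientGroup.eq_one_iff _).2 hmem)⟩
    exact (QuotientGroup.eq_one_iff _).1 (Subtype.ext_iff.1 this)
  · rintro H ⟨x, hx⟩ ⟨m, hm, hmem⟩
    obtain ⟨h, rfl⟩ := QuotientGroup.mk_surjective x
    exact Subtype.ext ((QuotientGroup.eq_one_iff _).2 (H h hx m hm
      ((QuotientGroup.eq_one_iff _).1 (Subtype.ext_iff.1 hmem))))

theorem groupIsTorsionFree_quotient_subgroupOf_iff {G : Type*} [Group G] (N K : Subgroup G)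
    [K.Normal] : GroupIsTorsionFree (N ⧸ K.subgroupOf N) ↔
      ∀ h ∈ N, ∀ m : ℕ, 0 < m → h ^ m ∈ K → h ∈ K := by
  simp only [GroupIsTorsionFree, isOfFinOrder_iff_pow_eq_one]
  constructor
  · intro H h hh m hm hmem
    exact (QuotientGroup.eq_one_iff (N := K.subgroupOf N) ⟨h, hh⟩).1
      (H (QuotientGroup.mk (s := K.subgroupOf N) ⟨h, hh⟩) ⟨m, hm,
        (QuotientGroup.eq_one_iff (N := K.subgroupOf N) ((⟨h, hh⟩ : N) ^ m)).2 hmem⟩)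
  · rintro H x ⟨m, hm, hmem⟩
    obtain ⟨⟨h, hh⟩, rfl⟩ := QuotientGroup.mk_surjective x
    exact (QuotientGroup.eq_one_iff (N := K.subgroupOf N) ⟨h, hh⟩).2 (H h hh m hm
      ((QuotientGroup.eq_one_iff (N := K.subgroupOf N) ((⟨h, hh⟩ : N) ^ m)).1 hmem))

end Abelian

/-- Projection along a compact factor is a closed map. This gives continuity of maps defined by
choice, below the section of θ and the quotient (θ - 1)/(t - 1). -/
theorem continuous_of_isClosed_graph {X Y : Type*} [TopologicalSpace X] [TopologicalSpace Y]
    [CompactSpace Y] {f : X → Y} (hf : IsClosed {z : X × Y | f z.1 = z.2}) : Continuous f := by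
  refine continuous_iff_isClosed.2 fun F hF => ?_
  have : f ⁻¹' F = Prod.fst '' ({z : X × Y | f z.1 = z.2} ∩ Prod.snd ⁻¹' F) := by
    ext a
    constructor
    · exact fun ha => ⟨(a, f a), ⟨rfl, ha⟩, rfl⟩
    · rintro ⟨⟨a, b⟩, ⟨hab, hb⟩, rfl⟩
      exact Set.mem_preimage.2 ((show f a = b from hab) ▸ hb)
  rw [this]
  exact isClosedMap_fst_of_compactSpace _ (hf.inter (hF.preimage continuous_snd))

/-! ### A procyclic complement to Ker θ. -/

section Complement

variable {p : ℕ} [Fact p.Prime] {G : Type*} [Group G] [TopologicalSpace G] [IsTopologicalGroup G]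
  [CompactSpace G] [IsProP p G]

/-- Some `p ^ j`-th power of `θ g` is `1` mod `p`, and raising to the power `p` is the identity on
𝔽_p. -/
theorem dvd_orientation_sub_one (θ : G →ₜ* ℤ_[p]ˣ) (g : G) : (p : ℤ_[p]) ∣ (θ g : ℤ_[p]) - 1 := by
  let U : Subgroup G := (congruenceUnits ((p : ℤ_[p]) ^ 1)).comap (θ : G →* ℤ_[p]ˣ)
  have : U.Normal := Subgroup.Normal.comap inferInstance _
  obtain ⟨j, hj⟩ := IsProP.exists_forall_pow_mem p (U := U)
    ((isOpen_congruenceUnits_pow 1).preimage θ.continuous_toFun)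
  have key : ∀ z : ℤ_[p], (p : ℤ_[p]) ∣ z ↔ PadicInt.toZMod z = 0 := fun z => by
    rw [← Ideal.mem_span_singleton, ← PadicInt.maximalIdeal_eq_span_p, ← PadicInt.ker_toZMod,
      RingHom.mem_ker]
  have h1 : (p : ℤ_[p]) ^ 1 ∣ ((θ (g ^ p ^ j) : ℤ_[p]ˣ) : ℤ_[p]) - 1 :=
    mem_congruenceUnits.1 (hj g)
  rw [pow_one, key, map_pow, Units.val_pow_eq_pow_val, map_sub, map_pow, ZMod.pow_card_pow,
    ← map_sub] at h1
  exact (key _).2 h1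

theorem exists_forall_mem_closure_zpowers_orientation (θ : G →ₜ* ℤ_[p]ˣ)
    (hθ : IsTorsionFreeOrientation θ) :
    ∃ x : G, (∀ g, θ g ∈ closure (Subgroup.zpowers (θ x) : Set ℤ_[p]ˣ)) ∧
      (x = 1 ∨ ¬ IsOfFinOrder (θ x)) := by
  have htf : ∀ g : G, IsOfFinOrder (θ g) → θ g = 1 := fun g hg => by
    have := hθ ⟨θ g, g, rfl⟩ (by
      rw [isOfFinOrder_iff_pow_eq_one] at hg ⊢
      exact hg.imp fun m hm => ⟨hm.1, Subtype.ext hm.2⟩)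
    exact Subtype.ext_iff.1 this
  obtain ⟨_, ⟨x, rfl⟩, hx⟩ := exists_mem_le_closure_zpowers
    (T := (θ : G →* ℤ_[p]ˣ).range) (isCompact_range θ.continuous_toFun)
    (by rintro _ ⟨g, rfl⟩; exact htf g) (by rintro _ ⟨g, rfl⟩; exact dvd_orientation_sub_one θ g)
  replace hx : ∀ g, θ g ∈ closure (Subgroup.zpowers (θ x) : Set ℤ_[p]ˣ) := fun g => hx ⟨g, rfl⟩
  by_cases hfin : IsOfFinOrder (θ x)
  -- Here the image of θ is trivial, but `x` itself might generate a nontrivial subgroup of Ker θ;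
  -- replacing it by `1` keeps the complement trivial.
  · refine ⟨1, fun g => ?_, Or.inl rfl⟩
    rw [map_one, ← htf x hfin]
    exact hx g
  · exact ⟨x, hx, Or.inr hfin⟩

/-- The order of `θ x` modulo `p ^ N` is a power of `p` that grows beyond any `p ^ j`, since `θ x`
has infinite order. So `θ (x ^ k)` near `1` forces `k` to be `p`-adically small, which makes θ
injective on the closure of the powers of `x`. -/
theorem exists_pow_dvd_of_orientation_zpow (θ : G →ₜ* ℤ_[p]ˣ) {x : G}
    (hx : ¬ IsOfFinOrder (θ x)) (j : ℕ) : ∃ N : ℕ, ∀ k : ℤ,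
      θ (x ^ k) ∈ congruenceUnits ((p : ℤ_[p]) ^ N) → (p ^ j : ℤ) ∣ k := by
  obtain ⟨N, hN⟩ : ∃ N : ℕ, θ (x ^ p ^ j) ∉ congruenceUnits ((p : ℤ_[p]) ^ N) := by
    by_contra! h
    refine hx (isOfFinOrder_iff_pow_eq_one.2
      ⟨p ^ j, pow_pos (Fact.out : p.Prime).pos j, ?_⟩)
    rw [← map_pow, Units.ext_iff, ← sub_eq_zero, Units.val_one]
    refine (PadicInt.ext_of_toZModPow).1 fun n => ?_
    rw [map_zero, ← RingHom.mem_ker, PadicInt.ker_toZModPow, Ideal.mem_span_singleton]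
    exact mem_congruenceUnits.1 (h n)
  let U : Subgroup G := (congruenceUnits ((p : ℤ_[p]) ^ N)).comap (θ : G →* ℤ_[p]ˣ)
  have : U.Normal := Subgroup.Normal.comap inferInstance _
  obtain ⟨e, he⟩ := IsProP.exists_forall_pow_mem p (U := U)
    ((isOpen_congruenceUnits_pow N).preimage θ.continuous_toFun)
  have hdvd : orderOf (QuotientGroup.mk (s := U) x) ∣ p ^ e := by
    rw [orderOf_dvd_iff_pow_eq_one, ← QuotientGroup.mk_pow, QuotientGroup.eq_one_iff]
    exact he x
  obtain ⟨i, -, hi⟩ := (Nat.dvd_prime_pow Fact.out).1 hdvd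
  refine ⟨N, fun k hk => ?_⟩
  have hk' : (orderOf (QuotientGroup.mk (s := U) x) : ℤ) ∣ k := by
    rw [orderOf_dvd_iff_zpow_eq_one, ← QuotientGroup.mk_zpow, QuotientGroup.eq_one_iff]
    exact hk
  rw [hi, Nat.cast_pow] at hk'
  refine (pow_dvd_pow _ ?_).trans hk'
  by_contra! hij
  refine hN ?_
  have : x ^ p ^ j ∈ U := by
    rw [← QuotientGroup.eq_one_iff, QuotientGroup.mk_pow, ← orderOf_dvd_iff_pow_eq_one, hi]
    exact pow_dvd_pow p hij.le
  exact this

variable [TotallyDisconnectedSpace G]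

/-- The kernel of a torsion-free orientation has a closed procyclic complement. -/
theorem exists_procyclic_complement (θ : G →ₜ* ℤ_[p]ˣ) (hθ : IsTorsionFreeOrientation θ) :
    ∃ x : G, (∀ g, θ g ∈ closure (Subgroup.zpowers (θ x) : Set ℤ_[p]ˣ)) ∧
      (∀ g, ∃ c ∈ (Subgroup.zpowers x).topologicalClosure, θ c = θ g) ∧
      ∀ c ∈ (Subgroup.zpowers x).topologicalClosure, θ c = 1 → c = 1 := by
  obtain ⟨x, hx, hord⟩ := exists_forall_mem_closure_zpowers_orientation θ hθ
  refine ⟨x, hx, fun g => ?_, fun c hc hc1 => ?_⟩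
  · have hcl : IsClosed (θ '' (Subgroup.zpowers x).topologicalClosure) :=
      ((Subgroup.isClosed_topologicalClosure _).isCompact.image θ.continuous_toFun).isClosed
    refine closure_minimal ?_ hcl (hx g)
    rintro _ ⟨k, rfl⟩
    exact ⟨x ^ k, subset_closure ⟨k, rfl⟩, map_zpow θ x k⟩
  · rcases hord with rfl | hord
    · have : closure ((Subgroup.zpowers (1 : G) : Subgroup G) : Set G) = {1} := by simp
      exact this.subset hc
    by_contra hne
    obtain ⟨U, hU⟩ := ProfiniteGrp.exist_openNormalSubgroup_sub_open_nhds_of_one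
      (isOpen_compl_singleton (x := c)) (Ne.symm hne)
    have hUo : IsOpen ((U.toSubgroup : Subgroup G) : Set G) := U.isOpen'
    obtain ⟨j, hj⟩ := IsProP.exists_forall_pow_mem p (U := U.toSubgroup) hUo
    obtain ⟨N, hN⟩ := exists_pow_dvd_of_orientation_zpow θ hord j
    have h1 : IsOpen {g : G | c⁻¹ * g ∈ U.toSubgroup} := hUo.preimage (continuous_const_mul c⁻¹)
    have h2 : IsOpen {g : G | θ g ∈ congruenceUnits ((p : ℤ_[p]) ^ N)} :=
      (isOpen_congruenceUnits_pow N).preimage θ.continuous_toFun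
    obtain ⟨_, ⟨hk1, hk2⟩, k, rfl⟩ := mem_closure_iff.1 hc _ (h1.inter h2)
      ⟨by simp, by
        change θ c ∈ congruenceUnits ((p : ℤ_[p]) ^ N)
        rw [hc1]
        exact one_mem _⟩
    obtain ⟨l, rfl⟩ := hN k hk2
    have hxk : x ^ ((p ^ j : ℤ) * l) ∈ U.toSubgroup := by
      rw [zpow_mul]
      refine U.toSubgroup.zpow_mem ?_ l
      exact_mod_cast hj x
    have hcU : c ∈ U.toSubgroup :=
      inv_mem_iff.1 ((U.toSubgroup.mul_mem_cancel_right hxk).1 hk1)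
    exact hU hcU rfl

end Complement

/-- The projection onto the complement of the kernel of a torsion-free orientation. -/
theorem exists_continuous_section {p : ℕ} [Fact p.Prime] {G : Type*} [Group G]
    [TopologicalSpace G] [IsTopologicalGroup G] [CompactSpace G] (θ : G →ₜ* ℤ_[p]ˣ) {x : G}
    (hsurj : ∀ g, ∃ c ∈ (Subgroup.zpowers x).topologicalClosure, θ c = θ g)
    (hinj : ∀ c ∈ (Subgroup.zpowers x).topologicalClosure, θ c = 1 → c = 1) :
    ∃ s : G →* G, Continuous s ∧ (∀ g, θ (s g) = θ g) ∧ ∀ h ∈ orientKer θ, s h = 1 := by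
  choose s hsC hsθ using hsurj
  have huniq : ∀ c ∈ (Subgroup.zpowers x).topologicalClosure, ∀ g, θ c = θ g → s g = c := by
    intro c hc g hcg
    refine mul_inv_eq_one.1 (hinj _ (mul_mem (hsC g) (inv_mem hc)) ?_)
    rw [map_mul, map_inv, hsθ, hcg, mul_inv_cancel]
  refine ⟨MonoidHom.mk' s fun a b => huniq _ (mul_mem (hsC a) (hsC b)) _ (by
    rw [map_mul, map_mul, hsθ, hsθ]), continuous_of_isClosed_graph ?_, hsθ, fun h hh =>
    huniq 1 (one_mem _) h (by rw [map_one]; exact hh.symm)⟩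
  -- By uniqueness the graph consists of the pairs `(a, b)` with `θ b = θ a` and `b` in the
  -- complement, both closed conditions.
  have : {z : G × G | MonoidHom.mk' s (fun a b => huniq _ (mul_mem (hsC a) (hsC b)) _ (by
      rw [map_mul, map_mul, hsθ, hsθ])) z.1 = z.2} =
      {z | θ z.2 = θ z.1} ∩ Prod.snd ⁻¹' (Subgroup.zpowers x).topologicalClosure := by
    ext ⟨a, b⟩
    exact ⟨fun h => (show s a = b from h) ▸ ⟨hsθ a, hsC a⟩, fun h => huniq b h.2 a h.1⟩
  rw [this]
  exact (isClosed_eq (θ.continuous_toFun.comp continuous_snd)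
    (θ.continuous_toFun.comp continuous_fst)).inter
    ((Subgroup.isClosed_topologicalClosure _).preimage continuous_snd)

/-! ### The profinite abelian group Ker θ / K and its characters. -/

section KummerModule

variable {p : ℕ} [Fact p.Prime] {G : Type*} [Group G] [TopologicalSpace G] [IsTopologicalGroup G]
  [CompactSpace G] [TotallyDisconnectedSpace G] [IsProP p G]

/-- The target is discrete and killed by `p ^ n`, so the approximating powers have the constant
image `z • φ h` from `k = n` on. -/
theorem map_padicPow_of_map_mul {N : Subgroup G} (hN : IsClosed (N : Set G)) {n : ℕ}
    {φ : N → TateMod p n} (hφ : Continuous φ) (hmul : ∀ a b, φ (a * b) = φ a + φ b) (h : N)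
    (z : ℤ_[p]) : φ ⟨padicPow (h : G) z, padicPow_mem hN h.2 z⟩ = z • φ h := by
  have hpow : ∀ m : ℕ, φ (h ^ m) = m • φ h := by
    intro m
    induction m with
    | zero =>
      have := hmul 1 1
      rw [one_mul] at this
      simpa using this
    | succ m ih => rw [pow_succ, hmul, ih, succ_nsmul]
  have hlim : Filter.Tendsto (fun k => h ^ z.appr k) Filter.atTop
      (nhds ⟨padicPow (h : G) z, padicPow_mem hN h.2 z⟩) := by
    rw [tendsto_subtype_rng]
    exact tendsto_padicPow (h : G) z
  refine tendsto_nhds_unique ((hφ.tendsto _).comp hlim) (tendsto_const_nhds.congr' ?_)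
  filter_upwards [Filter.eventually_ge_atTop n] with k hk
  rw [Function.comp_apply, hpow, ← Nat.cast_smul_eq_nsmul ℤ_[p], ← sub_eq_zero, ← sub_smul]
  refine TateMod.smul_eq_zero_of_pow_dvd ((pow_dvd_pow _ hk).trans ?_) _
  rw [← Ideal.mem_span_singleton]
  exact PadicInt.appr_spec k z

variable [T2Space G]

theorem padicPow_one (h : G) : padicPow h (1 : ℤ_[p]) = h := by
  rw [← neg_neg (1 : ℤ_[p]), padicPow_neg, inv_eq_iff_mul_eq_one]
  refine tendsto_nhds_unique ((tendsto_padicPow h (-1 : ℤ_[p])).mul_const h) ?_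
  simp_rw [← pow_succ]
  refine IsProP.tendsto_pow_of_dvd (p := p) h fun k => ?_
  have h1 := PadicInt.appr_spec k (-1 : ℤ_[p])
  rw [Ideal.mem_span_singleton] at h1
  have h2 := h1.neg_right
  rw [show -(-1 - ((-1 : ℤ_[p]).appr k : ℤ_[p])) =
    (((-1 : ℤ_[p]).appr k + 1 : ℕ) : ℤ_[p]) by push_cast; ring] at h2
  have h4 := (PadicInt.pow_p_dvd_int_iff k (((-1 : ℤ_[p]).appr k + 1 : ℕ) : ℤ)).1
    (by rwa [Int.cast_natCast])
  exact_mod_cast h4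

/-- The abelian group `Ker θ / K(G, θ)`. -/
abbrev KummerQuotient (θ : G →ₜ* ℤ_[p]ˣ) : Type _ :=
  orientKer θ ⧸ (kummerSubgroup θ).subgroupOf (orientKer θ)

noncomputable instance KummerQuotient.instCommGroup (θ : G →ₜ* ℤ_[p]ˣ) : CommGroup (KummerQuotient θ) where
  mul_comm x y := by
    obtain ⟨g, rfl⟩ := QuotientGroup.mk_surjective x
    obtain ⟨h, rfl⟩ := QuotientGroup.mk_surjective y
    rw [← QuotientGroup.mk_mul, ← QuotientGroup.mk_mul, eq_comm, QuotientGroup.eq,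
      Subgroup.mem_subgroupOf]
    -- For `g` in Ker θ the relation defining K reads `h⁻¹ * (g * h * g⁻¹)`, a commutator.
    have hg : θ g = 1 := g.2
    have := mul_padicPow_neg_mem_kummerSubgroup θ (g : G) h.2
    rw [hg, Units.val_one, padicPow_one] at this
    have h2 := (kummerSubgroup_normal θ).conj_mem _ this (g : G)⁻¹
    convert h2 using 1
    push_cast
    group

instance KummerQuotient.instT2Space (θ : G →ₜ* ℤ_[p]ˣ) : T2Space (KummerQuotient θ) := by
  have : IsClosed ((kummerSubgroup θ).subgroupOf (orientKer θ) : Set (orientKer θ)) :=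
    (isClosed_kummerSubgroup θ).preimage continuous_subtype_val
  infer_instance

instance KummerQuotient.instT2SpaceAdditive (θ : G →ₜ* ℤ_[p]ˣ) :
    T2Space (Additive (KummerQuotient θ)) :=
  KummerQuotient.instT2Space θ

instance KummerQuotient.instCompactSpace (θ : G →ₜ* ℤ_[p]ˣ) : CompactSpace (KummerQuotient θ) := by
  have : CompactSpace (orientKer θ) := isCompact_iff_compactSpace.1 (isClosed_orientKer θ).isCompact
  infer_instance

instance KummerQuotient.instNonarchimedeanAddGroup (θ : G →ₜ* ℤ_[p]ˣ) :
    NonarchimedeanAddGroup (Additive (KummerQuotient θ)) where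
  is_nonarchimedean O hO := by
    have : CompactSpace (orientKer θ) :=
      isCompact_iff_compactSpace.1 (isClosed_orientKer θ).isCompact
    let π : orientKer θ → Additive (KummerQuotient θ) := fun h => Additive.ofMul (QuotientGroup.mk h)
    have hπ : Continuous π := continuous_ofMul.comp QuotientGroup.continuous_mk
    have hπO : π ⁻¹' O ∈ nhds 1 := hπ.continuousAt.preimage_mem_nhds hO
    obtain ⟨W, hWO, hW, hW1⟩ := mem_nhds_iff.1 hπO
    obtain ⟨U, hU⟩ := ProfiniteGrp.exist_openNormalSubgroup_sub_open_nhds_of_one hW hW1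
    let V : Subgroup (KummerQuotient θ) := U.toSubgroup.map (QuotientGroup.mk' _)
    have hV : IsOpen (V : Set (KummerQuotient θ)) :=
      QuotientGroup.isOpenMap_coe _ U.isOpen'
    refine ⟨⟨Subgroup.toAddSubgroup V, hV⟩, ?_⟩
    rintro _ ⟨h, hh, rfl⟩
    exact hWO (hU hh)

theorem KummerQuotient.exists_forall_pow_nsmul_mem (θ : G →ₜ* ℤ_[p]ˣ)
    (U : AddSubgroup (Additive (KummerQuotient θ)))
    (hU : IsOpen (U : Set (Additive (KummerQuotient θ)))) :
    ∃ j : ℕ, ∀ a, p ^ j • a ∈ U := by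
  let π : orientKer θ → Additive (KummerQuotient θ) := fun h => Additive.ofMul (QuotientGroup.mk h)
  have hπ : Continuous π := continuous_ofMul.comp QuotientGroup.continuous_mk
  obtain ⟨W, hW, hWU⟩ := isOpen_induced_iff.1 (hU.preimage hπ)
  have hWU' : ∀ h : orientKer θ, (h : G) ∈ W ↔ π h ∈ U := fun h => Set.ext_iff.1 hWU h
  -- `V` is taken open in `G` and not in Ker θ, so that the pro-`p` property of `G` applies
  -- directly.
  obtain ⟨V, hV⟩ := ProfiniteGrp.exist_openNormalSubgroup_sub_open_nhds_of_one hW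
    ((hWU' 1).2 U.zero_mem)
  obtain ⟨j, hj⟩ := IsProP.exists_forall_pow_mem p (U := V.toSubgroup) V.isOpen'
  refine ⟨j, fun a => ?_⟩
  obtain ⟨h, hh⟩ := QuotientGroup.mk_surjective a.toMul
  exact (show π h = a from congrArg Additive.ofMul hh) ▸ (hWU' (h ^ p ^ j)).1 (hV (hj (h : G)))

theorem KummerQuotient.map_conj (θ : G →ₜ* ℤ_[p]ˣ) {n : ℕ}
    (f : Additive (KummerQuotient θ) →+ TateMod p n) (hf : Continuous f) (g : G) (h : orientKer θ) :
    f (Additive.ofMul (QuotientGroup.mk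
      ⟨g * h * g⁻¹, (MonoidHom.normal_ker _).conj_mem (h : G) h.2 g⟩)) =
      (θ g : ℤ_[p]) • f (Additive.ofMul (QuotientGroup.mk h)) := by
  rw [← map_padicPow_of_map_mul (isClosed_orientKer θ)
    (φ := fun h => f (Additive.ofMul (QuotientGroup.mk h)))
    (hf.comp (continuous_ofMul.comp QuotientGroup.continuous_mk)) (fun a b => by
      rw [← map_add]; rfl) h (θ g : ℤ_[p])]
  congr 2
  rw [eq_comm, QuotientGroup.eq, Subgroup.mem_subgroupOf]
  exact mul_padicPow_neg_mem_kummerSubgroup θ g h.2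

end KummerModule

/-! ### Restricting, extending and lifting cocycles. -/

section Cocycles

variable {p : ℕ} [Fact p.Prime] {G : Type*} [Group G] [TopologicalSpace G] {θ : G →ₜ* ℤ_[p]ˣ}
  {n : ℕ} {c : G → TateMod p n}

theorem mem_contCocycles₁_tateAction : c ∈ contCocycles₁ (tateAction θ n) ↔
    Continuous c ∧ ∀ g h, c (g * h) = c g + (θ g : ℤ_[p]) • c h := Iff.rfl

theorem contCocycles₁_tateAction_one (hc : c ∈ contCocycles₁ (tateAction θ n)) : c 1 = 0 := by
  have := hc.2 1 1
  rw [mul_one, map_one] at this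
  simpa using this

theorem contCocycles₁_tateAction_mul (hc : c ∈ contCocycles₁ (tateAction θ n)) {h : G}
    (hh : h ∈ orientKer θ) (g : G) : c (h * g) = c h + c g := by
  have h1 : θ h = 1 := hh
  rw [(mem_contCocycles₁_tateAction.1 hc).2, h1, Units.val_one, one_smul]

theorem contCocycles₁_tateAction_conj (hc : c ∈ contCocycles₁ (tateAction θ n)) {h : G}
    (hh : h ∈ orientKer θ) (g : G) : c (g * h * g⁻¹) = (θ g : ℤ_[p]) • c h := by
  have h1 := contCocycles₁_tateAction_mul hc ((MonoidHom.normal_ker _).conj_mem h hh g) g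
  rw [inv_mul_cancel_right, (mem_contCocycles₁_tateAction.1 hc).2, add_comm] at h1
  exact (add_right_cancel h1).symm

theorem continuous_smul_tateMod [IsTopologicalGroup G] (θ : G →ₜ* ℤ_[p]ˣ) (m : TateMod p n) :
    Continuous fun g => (θ g : ℤ_[p]) • m := by
  obtain ⟨z, rfl⟩ := Submodule.Quotient.mk_surjective _ m
  exact continuous_quot_mk.comp ((Units.continuous_val.comp θ.continuous_toFun).mul continuous_const)

/-- Surjectivity of the Kummer maps in terms of cocycles. -/
theorem isKummerian_iff_exists_lift [IsTopologicalGroup G] : IsKummerian θ ↔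
    ∀ n : ℕ, ∀ c ∈ contCocycles₁ (tateAction θ 1), ∃ b ∈ contCocycles₁ (tateAction θ (n + 1)),
      ∀ g, tateProj n.succ_pos (b g) = c g := by
  constructor
  · intro H n c hc
    obtain ⟨x, hx⟩ := H (n + 1) n.succ_pos (QuotientAddGroup.mk ⟨c, hc⟩)
    obtain ⟨⟨b, hb⟩, rfl⟩ := QuotientAddGroup.mk_surjective x
    obtain ⟨m, hm⟩ := QuotientAddGroup.eq.1 hx
    -- The lift holds only up to a coboundary; lifting its defining element `m` allows it to be
    -- absorbed into `b`.
    obtain ⟨m, rfl⟩ := tateProj_surjective n.succ_pos m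
    have hcob : (fun g => (θ g : ℤ_[p]) • m - m) ∈ contCocycles₁ (tateAction θ (n + 1)) := by
      refine mem_contCocycles₁_tateAction.2
        ⟨(continuous_smul_tateMod θ m).sub continuous_const, fun g h => ?_⟩
      rw [map_mul, Units.val_mul, mul_smul, smul_sub]
      abel
    refine ⟨_, add_mem hb hcob, fun g => ?_⟩
    have h1 : -tateProj n.succ_pos (b g) + c g =
      (θ g : ℤ_[p]) • tateProj n.succ_pos m - tateProj n.succ_pos m := hm g
    rw [Pi.add_apply, map_add, map_sub, map_smul, ← h1, add_neg_cancel_left]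
  · intro H n hn x
    obtain ⟨n, rfl⟩ := Nat.exists_eq_add_of_le' hn
    obtain ⟨⟨c, hc⟩, rfl⟩ := QuotientAddGroup.mk_surjective x
    obtain ⟨b, hb, hbc⟩ := H n c hc
    exact ⟨QuotientAddGroup.mk ⟨b, hb⟩, congrArg QuotientAddGroup.mk (Subtype.ext (funext hbc))⟩

variable [IsTopologicalGroup G] [CompactSpace G] [TotallyDisconnectedSpace G]
  [IsProP p G]

/-- Cocycles that vanish on `Ker θ` lift: they are `p`-adic multiples of `g ↦ (θ g - 1) / (t - 1)`,
where `t` generates the image of `θ`. -/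
theorem exists_lift_cocycle_of_eq_zero (hθ : IsTorsionFreeOrientation θ) (n : ℕ)
    {d : G → TateMod p 1} (hd : d ∈ contCocycles₁ (tateAction θ 1))
    (hd0 : ∀ h ∈ orientKer θ, d h = 0) : ∃ b ∈ contCocycles₁ (tateAction θ (n + 1)),
      ∀ g, tateProj n.succ_pos (b g) = d g := by
  obtain ⟨x, hgen, hsurj, -⟩ := exists_procyclic_complement θ hθ
  by_cases hx : (θ x : ℤ_[p]) - 1 = 0
  · refine ⟨0, zero_mem _, fun g => ?_⟩
    rw [hd0 g, Pi.zero_apply, map_zero]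
    have := dvd_sub_one_of_mem_closure_zpowers (zero_dvd_iff.2 hx) (hgen g)
    exact Units.ext (sub_eq_zero.1 (zero_dvd_iff.1 this))
  choose q hq using fun g => dvd_sub_one_of_mem_closure_zpowers dvd_rfl (hgen g)
  have hqcont : Continuous q := by
    refine continuous_of_isClosed_graph ?_
    have : {z : G × ℤ_[p] | q z.1 = z.2} =
        {z | (θ z.1 : ℤ_[p]) - 1 = ((θ x : ℤ_[p]) - 1) * z.2} := by
      ext ⟨g, z⟩
      change q g = z ↔ (θ g : ℤ_[p]) - 1 = ((θ x : ℤ_[p]) - 1) * z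
      rw [hq g, mul_right_inj' hx]
    rw [this]
    exact isClosed_eq (((Units.continuous_val.comp θ.continuous_toFun).comp continuous_fst).sub
      continuous_const) (continuous_const.mul continuous_snd)
  have hqx : q x = 1 := mul_left_cancel₀ hx (by rw [← hq x, mul_one])
  have hqmul : ∀ g h, q (g * h) = q g + θ g * q h := fun g h => by
    refine mul_left_cancel₀ hx ?_
    rw [← hq, map_mul, Units.val_mul]
    linear_combination hq g + (θ g : ℤ_[p]) * hq h
  obtain ⟨y, hy⟩ := Submodule.Quotient.mk_surjective _ (d x)
  let b (m : ℕ) : G → TateMod p m := fun g => Submodule.Quotient.mk (q g * y)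
  have hb : ∀ m, b m ∈ contCocycles₁ (tateAction θ m) := fun m =>
    ⟨continuous_quot_mk.comp (hqcont.mul continuous_const), fun g h => by
      rw [tateAction_apply, ← Submodule.Quotient.mk_smul, ← Submodule.Quotient.mk_add,
        smul_eq_mul, ← mul_assoc, ← add_mul, ← hqmul]⟩
  -- `b (n + 1)` reduces to `b 1`, so it remains to see `b 1 = d`. Both vanish on Ker θ and agree at
  -- `x`, and Ker θ together with the closure of the powers of `x` generates `G`.
  refine ⟨b (n + 1), hb _, fun g => ?_⟩
  have he := sub_mem (hb 1) hd
  set e := b 1 - d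
  have heker : ∀ h ∈ orientKer θ, e h = 0 := fun h hh => by
    have h1 : θ h = 1 := hh
    have : q h = 0 := mul_left_cancel₀ hx (by rw [← hq h, h1, Units.val_one, sub_self, mul_zero])
    simp only [e, b, Pi.sub_apply, this, zero_mul, Submodule.Quotient.mk_zero, hd0 h hh, sub_zero]
  let L : Subgroup G :=
    { carrier := {k | e k = 0}
      one_mem' := contCocycles₁_tateAction_one he
      mul_mem' := fun {a b} ha hb => by
        rw [Set.mem_ofPred_eq] at *
        rw [(mem_contCocycles₁_tateAction.1 he).2, ha, hb, smul_zero, add_zero]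
      inv_mem' := fun {a} ha => by
        rw [Set.mem_ofPred_eq] at *
        have := (mem_contCocycles₁_tateAction.1 he).2 a⁻¹ a
        rwa [inv_mul_cancel, contCocycles₁_tateAction_one he, ha, smul_zero, add_zero,
          eq_comm] at this }
  have hxL : x ∈ L := by
    change b 1 x - d x = 0
    rw [← hy]
    simp only [b, hqx, one_mul, sub_self]
  have hCL : (Subgroup.zpowers x).topologicalClosure ≤ L :=
    Subgroup.topologicalClosure_minimal _ (Subgroup.zpowers_le.2 hxL)
      (isClosed_singleton.preimage he.1)
  obtain ⟨k, hk, hkg⟩ := hsurj g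
  have hgL : g ∈ L := by
    rw [← inv_mul_cancel_right g k]
    refine L.mul_mem (heker _ ?_) (hCL hk)
    rw [MonoidHom.mem_ker, map_mul, map_inv]
    change θ g * (θ k)⁻¹ = 1
    rw [hkg, mul_inv_cancel]
  exact sub_eq_zero.1 hgL

/-- On Ker θ a cocycle is a continuous homomorphism that takes both `g * h * g⁻¹` and `h ^ θ(g)` to
`θ g • c h`, so it kills the generators of K. -/
theorem contCocycles₁_tateAction_eq_zero (hc : c ∈ contCocycles₁ (tateAction θ n)) {k : G}
    (hk : k ∈ kummerSubgroup θ) : c k = 0 := by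
  let L : Subgroup G :=
    { carrier := {k | k ∈ orientKer θ ∧ c k = 0}
      one_mem' := ⟨one_mem _, contCocycles₁_tateAction_one hc⟩
      mul_mem' := fun {a b} ha hb => ⟨mul_mem ha.1 hb.1, by
        rw [contCocycles₁_tateAction_mul hc ha.1, ha.2, hb.2, add_zero]⟩
      inv_mem' := fun {a} ha => ⟨inv_mem ha.1, by
        have := contCocycles₁_tateAction_mul hc ha.1 a⁻¹
        rwa [mul_inv_cancel, contCocycles₁_tateAction_one hc, ha.2, zero_add, eq_comm] at this⟩ }
  have hL : IsClosed (L : Set G) :=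
    (isClosed_orientKer θ).inter (isClosed_singleton.preimage hc.1)
  suffices kummerSubgroup θ ≤ L from (this hk).2
  refine Subgroup.topologicalClosure_minimal _ ?_ hL
  rw [Subgroup.closure_le]
  rintro _ ⟨g, h, hh, rfl⟩
  have h1 := padicPow_mem (isClosed_orientKer θ) hh (-(θ g : ℤ_[p]))
  have h2 := (MonoidHom.normal_ker (θ : G →* ℤ_[p]ˣ)).conj_mem h hh g
  rw [mul_assoc, mul_assoc, ← mul_assoc g]
  refine ⟨mul_mem h1 h2, ?_⟩
  rw [contCocycles₁_tateAction_mul hc h1, contCocycles₁_tateAction_conj hc hh]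
  have h3 := map_padicPow_of_map_mul (isClosed_orientKer θ) (φ := fun h => c h)
    (hc.1.comp continuous_subtype_val) (fun a b => contCocycles₁_tateAction_mul hc a.2 b)
    ⟨h, hh⟩ (-(θ g : ℤ_[p]))
  rw [h3, neg_smul, neg_add_cancel]

variable [T2Space G]

/-- The restriction of a cocycle to `Ker θ`. -/
theorem exists_restrict_cocycle (hc : c ∈ contCocycles₁ (tateAction θ n)) :
    ∃ f : Additive (KummerQuotient θ) →+ TateMod p n, Continuous f ∧
      ∀ h : orientKer θ, f (Additive.ofMul (QuotientGroup.mk h)) = c h := by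
  let φ : orientKer θ →* Multiplicative (TateMod p n) :=
    MonoidHom.mk' (fun h => Multiplicative.ofAdd (c h)) fun a b =>
      congrArg Multiplicative.ofAdd (contCocycles₁_tateAction_mul hc a.2 b)
  let ψ : KummerQuotient θ →* Multiplicative (TateMod p n) :=
    QuotientGroup.lift _ φ fun k hk =>
      congrArg Multiplicative.ofAdd (contCocycles₁_tateAction_eq_zero hc hk)
  refine ⟨MonoidHom.toAdditiveLeft ψ, ?_, fun h => rfl⟩
  exact continuous_quot_lift _ (hc.1.comp continuous_subtype_val)

/-- Homomorphisms on `Ker θ / K(G, θ)` extend to cocycles. -/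
theorem exists_extend_cocycle (hθ : IsTorsionFreeOrientation θ)
    (f : Additive (KummerQuotient θ) →+ TateMod p n) (hf : Continuous f) :
    ∃ c ∈ contCocycles₁ (tateAction θ n),
      ∀ h : orientKer θ, c h = f (Additive.ofMul (QuotientGroup.mk h)) := by
  obtain ⟨x, -, hsurj, hinj⟩ := exists_procyclic_complement θ hθ
  obtain ⟨s, hs, hsθ, hsker⟩ := exists_continuous_section θ hsurj hinj
  have hmem : ∀ g, g * (s g)⁻¹ ∈ orientKer θ := fun g => by
    rw [MonoidHom.mem_ker, map_mul, map_inv]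
    change θ g * (θ (s g))⁻¹ = 1
    rw [hsθ, mul_inv_cancel]
  -- Apply `f` to the Ker θ-component `g * (s g)⁻¹`. The component of `g * g'` is that of `g` times
  -- the conjugate by `s g` of that of `g'`, so equivariance of `f` is the cocycle identity.
  refine ⟨fun g => f (Additive.ofMul (QuotientGroup.mk ⟨_, hmem g⟩)), ⟨?_, fun g g' => ?_⟩,
    fun h => ?_⟩
  · exact hf.comp (continuous_ofMul.comp (QuotientGroup.continuous_mk.comp
      ((continuous_id.mul hs.inv).subtype_mk _)))
  · rw [tateAction_apply, ← hsθ g, ← KummerQuotient.map_conj θ f hf (s g) ⟨_, hmem g'⟩, ← map_add,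
      ← ofMul_mul, ← QuotientGroup.mk_mul]
    refine congrArg (fun h => f (Additive.ofMul (QuotientGroup.mk h))) (Subtype.ext ?_)
    simp only [map_mul, Subgroup.coe_mul]
    group
  · refine congrArg (fun h => f (Additive.ofMul (QuotientGroup.mk h))) (Subtype.ext ?_)
    simp only [hsker _ h.2, inv_one, mul_one]

theorem isKummerian_iff_forall_pow_mem (hθ : IsTorsionFreeOrientation θ) : IsKummerian θ ↔
    ∀ h ∈ orientKer θ, ∀ m : ℕ, 0 < m → h ^ m ∈ kummerSubgroup θ → h ∈ kummerSubgroup θ := by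
  rw [isKummerian_iff_exists_lift]
  have hmk : ∀ h : orientKer θ, (Additive.ofMul (QuotientGroup.mk h) :
      Additive (KummerQuotient θ)) = 0 ↔ (h : G) ∈ kummerSubgroup θ :=
    fun h => QuotientGroup.eq_one_iff (N := (kummerSubgroup θ).subgroupOf (orientKer θ)) h
  constructor
  · intro H h hh m hm hmem
    refine (hmk ⟨h, hh⟩).1 (nsmul_eq_zero_of_lift_character (p := p)
      (KummerQuotient.exists_forall_pow_nsmul_mem θ) (fun φ hφ n => ?_) _ m hm
      ((hmk ((⟨h, hh⟩ : orientKer θ) ^ m)).2 hmem))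
    obtain ⟨c, hc, hcφ⟩ := exists_extend_cocycle hθ φ hφ
    obtain ⟨b, hb, hbc⟩ := H n c hc
    obtain ⟨ψ, -, hψ⟩ := exists_restrict_cocycle hb
    refine ⟨ψ, fun a => ?_⟩
    obtain ⟨h, hh⟩ := QuotientGroup.mk_surjective a.toMul
    obtain rfl : Additive.ofMul (QuotientGroup.mk h) = a := congrArg Additive.ofMul hh
    rw [hψ, hbc, hcφ]
  · intro H n c hc
    obtain ⟨φ, hφ, hφc⟩ := exists_restrict_cocycle hc
    obtain ⟨ψ, hψ, hψφ⟩ := exists_lift_character (fun a m hm ha => by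
      obtain ⟨⟨h, hker⟩, hh⟩ := QuotientGroup.mk_surjective a.toMul
      obtain rfl : Additive.ofMul (QuotientGroup.mk ⟨h, hker⟩) = a := congrArg Additive.ofMul hh
      exact (hmk ⟨h, hker⟩).2 (H h hker m hm ((hmk ((⟨h, hker⟩ : orientKer θ) ^ m)).1 ha))) n φ hφ
    obtain ⟨b, hb, hbψ⟩ := exists_extend_cocycle hθ ψ hψ
    have hb1 : (fun g => tateProj n.succ_pos (b g)) ∈ contCocycles₁ (tateAction θ 1) :=
      (contCocycles₁Map (ρ := tateAction θ (n + 1)) (ρ' := tateAction θ 1) (tateProj n.succ_pos)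
        (continuous_tateProj _) (fun g m => by simp only [tateAction_apply, map_smul]) ⟨b, hb⟩).2
    -- The extension `b` of the lifted character reduces to `c` only on Ker θ; the difference
    -- vanishes there and so lifts separately.
    obtain ⟨a, ha, had⟩ := exists_lift_cocycle_of_eq_zero hθ n (sub_mem hc hb1) (fun h hh => by
      rw [Pi.sub_apply, hbψ ⟨h, hh⟩, hψφ, hφc, sub_self])
    exact ⟨b + a, add_mem hb ha, fun g => by
      rw [Pi.add_apply, map_add, had, Pi.sub_apply, add_sub_cancel]⟩

end Cocycles

theorem theorem6p10 (p : ℕ) [Fact p.Prime] (G : Type*) [Group G] [TopologicalSpace G]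
    [IsTopologicalGroup G] [CompactSpace G] [T2Space G] [TotallyDisconnectedSpace G] [IsProP p G]
    (θ : G →ₜ* ℤ_[p]ˣ) (hθ : IsTorsionFreeOrientation θ) :
    List.TFAE [
      IsKummerian θ,
      GroupIsTorsionFree (orientKer θ ⧸ (kummerSubgroup θ).subgroupOf (orientKer θ)),
      IsOrientAbelian (quotientOrientation θ (kummerSubgroup θ) (kummerSubgroup_le_orientKer θ))] := by
  rw [isKummerian_iff_forall_pow_mem hθ, groupIsTorsionFree_quotient_subgroupOf_iff,
    isOrientAbelian_quotientOrientation_iff]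
  simp
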